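/- Let $\rho_0$ be a quantum state (a positive semidefinite matrix of trace one) on a finite-dimensional complex Hilbert space $\mathcal H=\mathcal H_+\oplus\mathcal H_0$, where $\mathcal H_+=\operatorname{supp}(\rho_0)=\ker(\rho_0)^\perp$ and $\mathcal H_0=\ker(\rho_0)$. Fix an orthonormal eigenbasis of $\rho_0$ and write in it $$\rho_0=\begin{pmatrix}\Lambda_{+}&0\\0&0\end{pmatrix},\qquad \nu=\begin{pmatrix}\nu_{B}&\nu_{C}\\ \nu_{C}^\dagger&\nu_{D}\end{pmatrix},$$ with $\Lambda_+$ diagonal with positive entries. Let $\|\cdot\|$ be the Hilbert–Schmidt norm. Fix constants $K\in\mathbb R$ and $c>0$. Consider perturbations $\nu_1,\nu_2$ of $\rho_0$ (Hermitian, of trace zero, with $\rho_i=\rho_0+\nu_i$ positive semidefinite) that extend the support, in the sense that for $i=1,2$: $\operatorname{supp}(\nu_i)\supseteq\mathcal H_0$; $\|\nu_i\|^2/\|\nu_{i,D}\|\le K\|\nu_i\|$; and $\nu_{i,D}\ge c\,\|\nu_{i,D}\|\,I$, that is, the normalized block $\nu_{i,D}/\|\nu_{i,D}\|$ has full rank on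 $\mathcal H_0$ with smallest eigenvalue at least $c$. (If $\mathcal H_0=\{0\}$ the conditions on $\nu_{i,D}$ are void.) Let $$\xi(\rho_1,\rho_2)=\max_{s\in[0,1]}\bigl(-\log\operatorname{Tr}[\rho_1^{s}\rho_2^{1-s}]\bigr)$$ be the quantum Chernoff bound. Then, for all such $\nu_1,\nu_2$ of sufficiently small norm, the maximum and the minimum below are attained and $$\xi(\rho_1,\rho_2)=-\min_{s\in[0,1]}\Bigl(s\operatorname{Tr}[\nu_{1,B}]+(1-s)\operatorname{Tr}[\nu_{2,B}]+\operatorname{Tr}\bigl[\nu_{1,D}^{\,s}\,\nu_{2,D}^{\,1-s}\bigr]\Bigr)+O\bigl(\max(\|\nu_1\|,\|\nu_2\|)^2\bigr),$$ where the bound on the norms and the constant in $O(\cdot)$ depend only on $\rho_0$ with its chosen eigenbasis, on $K$ and on $c$, and are uniform in $\nu_1,\nu_2$. -/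

import Mathlib

open scoped Matrix ComplexOrder

noncomputable section

namespace ChernoffPert

/-- A (finite-dimensional) quantum state: a positive semidefinite matrix of trace one. -/
def IsState {n : Type*} [Fintype n] (ρ : Matrix n n ℂ) : Prop :=
  ρ.PosSemidef ∧ ρ.trace = 1

/-- `ν` is a perturbation of the state `ρ₀`: it is Hermitian and traceless, and `ρ₀ + ν` is
positive semidefinite (so that `ρ₀ + ν` is again a state). -/
structure IsStatePerturbation {n : Type*} [Fintype n] (ρ₀ ν : Matrix n n ℂ) : Prop where
  isHermitian : ν.IsHermitian
  trace_eq_zero : ν.trace = 0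
  posSemidef : (ρ₀ + ν).PosSemidef

/-- The support of an operator: the orthogonal complement of its kernel. -/
def supp {n : Type*} [Fintype n] [DecidableEq n] (A : Matrix n n ℂ) :
    Submodule ℂ (EuclideanSpace ℂ n) :=
  (LinearMap.ker (Matrix.toEuclideanLin A))ᗮ

/-- The Hilbert-Schmidt (Frobenius) norm. -/
def hsNorm {m n : Type*} [Fintype m] [Fintype n] (A : Matrix m n ℂ) : ℝ :=
  Real.sqrt (∑ i, ∑ j, ‖A i j‖ ^ 2)

/-- The power `A ^ s` of a Hermitian positive semidefinite matrix, as a primary matrix function: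
diagonalize `A` and apply `x ↦ x ^ s` to the eigenvalues. -/
def mpow {n : Type*} [Fintype n] [DecidableEq n] (A : Matrix n n ℂ) (s : ℝ) : Matrix n n ℂ :=
  cfc (fun x : ℝ => x ^ s) A

/-- `ξ_s(ρ₁, ρ₂) = -log Tr[ρ₁ ^ s ρ₂ ^ (1 - s)]`. -/
def chernoff {n : Type*} [Fintype n] [DecidableEq n] (ρ₁ ρ₂ : Matrix n n ℂ) (s : ℝ) : ℝ :=
  -Real.log (mpow ρ₁ s * mpow ρ₂ (1 - s)).trace.re

/-- `ξ` is the quantum Chernoff bound of `ρ₁` and `ρ₂`: the maximum of `ξ_s(ρ₁, ρ₂)` over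
`s ∈ [0, 1]`. -/
def IsChernoffBound {n : Type*} [Fintype n] [DecidableEq n] (ρ₁ ρ₂ : Matrix n n ℂ) (ξ : ℝ) :
    Prop :=
  IsGreatest (chernoff ρ₁ ρ₂ '' Set.Icc 0 1) ξ

/-- The columns of `U` are an orthonormal eigenbasis of `ρ₀`; the columns indexed by `p` belong to
the nonzero eigenvalues `lam k > 0`, those indexed by `z` to the eigenvalue zero. Equivalently
`ρ₀ = U (diag(lam), 0; 0, 0) Uᴴ` with `U` unitary. -/
structure IsEigenbasis {n p z : Type*} [Fintype n] [DecidableEq n] [Fintype p] [DecidableEq p]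
    [Fintype z] [DecidableEq z] (ρ₀ : Matrix n n ℂ) (U : Matrix n (p ⊕ z) ℂ) (lam : p → ℝ) :
    Prop where
  conjTranspose_mul : Uᴴ * U = 1
  mul_conjTranspose : U * Uᴴ = 1
  pos : ∀ k, 0 < lam k
  eq_blocks : Uᴴ * ρ₀ * U = Matrix.fromBlocks (Matrix.diagonal fun k => (lam k : ℂ)) 0 0 0

/-- The block `ν_B` of `ν` on the support of `ρ₀`, in the eigenbasis `U`. -/
def blockB {n p z : Type*} [Fintype n] (U : Matrix n (p ⊕ z) ℂ) (ν : Matrix n n ℂ) :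
    Matrix p p ℂ :=
  (Uᴴ * ν * U).toBlocks₁₁

/-- The block `ν_D` of `ν` on the kernel of `ρ₀`, in the eigenbasis `U`. -/
def blockD {n p z : Type*} [Fintype n] (U : Matrix n (p ⊕ z) ℂ) (ν : Matrix n n ℂ) :
    Matrix z z ℂ :=
  (Uᴴ * ν * U).toBlocks₂₂

/-- The first-order expression
`s Tr[ν_{1,B}] + (1 - s) Tr[ν_{2,B}] + Tr[ν_{1,D} ^ s ν_{2,D} ^ (1 - s)]`. -/
def firstOrder {n p z : Type*} [Fintype n] [Fintype p] [Fintype z] [DecidableEq z]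
    (U : Matrix n (p ⊕ z) ℂ) (ν₁ ν₂ : Matrix n n ℂ) (s : ℝ) : ℝ :=
  s * (blockB U ν₁).trace.re + (1 - s) * (blockB U ν₂).trace.re
    + (mpow (blockD U ν₁) s * mpow (blockD U ν₂) (1 - s)).trace.re

/-- `ν` is a support-extending perturbation of `ρ₀`, with quantitative constants `K` and `c`:
the support of `ν` contains the kernel of `ρ₀`, `‖ν‖² / ‖ν_D‖ ≤ K ‖ν‖`, and the normalized block
`ν_D / ‖ν_D‖` has full rank with smallest eigenvalue at least `c`. -/
structure IsSupportExtending {n p z : Type*} [Fintype n] [DecidableEq n] [Fintype p]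
    [Fintype z] [DecidableEq z] (K c : ℝ) (ρ₀ : Matrix n n ℂ)
    (U : Matrix n (p ⊕ z) ℂ) (ν : Matrix n n ℂ) : Prop extends IsStatePerturbation ρ₀ ν where
  ker_le_supp : LinearMap.ker (Matrix.toEuclideanLin ρ₀) ≤ supp ν
  ratio_le : hsNorm ν ^ 2 / hsNorm (blockD U ν) ≤ K * hsNorm ν
  full_rank : (blockD U ν - ((c * hsNorm (blockD U ν) : ℝ) : ℂ) • (1 : Matrix z z ℂ)).PosSemidef

end ChernoffPert

end

/-! With eigenvalues `a j`, `b l` of `ρ₀ + ν₁`, `ρ₀ + ν₂` and eigenvector overlaps `x j l`, one has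
`Tr[ρ₁^s ρ₂^(1-s)] = ∑ a^s b^(1-s) |x|²`. Since both traces are one, `Tr[ρ₁^s ρ₂^(1-s)] - 1 = ∑ g
|x|²` with the gap `g = a^s b^(1-s) - s a - (1-s) b`. Replacing `x` by the part `y` of the overlap
carried by the kernel of `ρ₀` costs only `O(ε²)`, `ε = max ‖νᵢ‖` (`abs_overlap_sub_mul_gap_le`): for
two small eigenvalues `x - y` is `O(ε²)`, for a mixed pair both overlaps are `O(ε)`, and for two
large ones `y` is `O(ε²)` while `g` is quadratic in `a - b`.

The sum `∑ g |y|²` is an expression in the kernel compressions of the powers and in the traces of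
`ν_D`, which equal `-Tr ν_B` by tracelessness (`sum_overlap_sub_mul_gap`). The compressions agree
with the powers of `ν_D` up to an error small relative to `ε^s` (`norm_conjDiag_sub_apply_le`); a
cruder bound would not suffice, since the two factors have sizes `ε^s` and `ε^(1-s)` and only their
product is `ε`. This is where the eigenvalues of `ν_D` must be comparable to `‖ν‖`.

Thus the trace is `1 + firstOrder + O(ε²)` uniformly in `s`; expanding the logarithm and comparing
extrema finishes the proof. -/

namespace ChernoffPert

open Matrix

/-! ### Hilbert–Schmidt norm and entrywise estimates. -/

section HSNorm

variable {m n k : Type*} [Fintype m] [Fintype n] [Fintype k]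

lemma hsNorm_nonneg (A : Matrix m n ℂ) : 0 ≤ hsNorm A := Real.sqrt_nonneg _

lemma hsNorm_sq (A : Matrix m n ℂ) : hsNorm A ^ 2 = ∑ i, ∑ j, ‖A i j‖ ^ 2 :=
  Real.sq_sqrt (by positivity)

lemma norm_entry_le_hsNorm (A : Matrix m n ℂ) (i : m) (j : n) : ‖A i j‖ ≤ hsNorm A := by
  refine Real.le_sqrt_of_sq_le ?_
  calc ‖A i j‖ ^ 2 ≤ ∑ j, ‖A i j‖ ^ 2 :=
        Finset.single_le_sum (f := fun j => ‖A i j‖ ^ 2) (fun _ _ => by positivity)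
          (Finset.mem_univ j)
    _ ≤ _ := Finset.single_le_sum (f := fun i => ∑ j, ‖A i j‖ ^ 2) (fun _ _ => by positivity)
          (Finset.mem_univ i)

lemma hsNorm_sq_eq_trace (A : Matrix m n ℂ) : hsNorm A ^ 2 = (A * Aᴴ).trace.re := by
  simp [hsNorm_sq, Matrix.trace, Matrix.mul_apply, Complex.mul_conj, Complex.normSq_eq_norm_sq,
    -Complex.ofReal_pow]

lemma hsNorm_sq_eq_trace' (A : Matrix m n ℂ) : hsNorm A ^ 2 = (Aᴴ * A).trace.re := by
  rw [hsNorm_sq_eq_trace, Matrix.trace_mul_comm]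

lemma hsNorm_mul_of_coisometry [DecidableEq n] (A : Matrix m n ℂ) {B : Matrix n k ℂ}
    (hB : B * Bᴴ = 1) : hsNorm (A * B) = hsNorm A := by
  rw [← sq_eq_sq₀ (hsNorm_nonneg _) (hsNorm_nonneg _), hsNorm_sq_eq_trace, hsNorm_sq_eq_trace,
    Matrix.conjTranspose_mul, Matrix.mul_assoc, ← Matrix.mul_assoc B, hB, Matrix.one_mul]

lemma hsNorm_mul_of_isometry [DecidableEq n] {B : Matrix k n ℂ} (A : Matrix n m ℂ)
    (hB : Bᴴ * B = 1) : hsNorm (B * A) = hsNorm A := by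
  rw [← sq_eq_sq₀ (hsNorm_nonneg _) (hsNorm_nonneg _), hsNorm_sq_eq_trace', hsNorm_sq_eq_trace',
    Matrix.conjTranspose_mul, Matrix.mul_assoc, ← Matrix.mul_assoc Bᴴ, hB, Matrix.one_mul]

lemma hsNorm_toBlocks₂₂_le (A : Matrix (m ⊕ n) (m ⊕ n) ℂ) : hsNorm A.toBlocks₂₂ ≤ hsNorm A := by
  refine Real.sqrt_le_sqrt ?_
  simp only [Fintype.sum_sum_type, Matrix.toBlocks₂₂, Matrix.of_apply]
  refine le_add_of_nonneg_of_le (by positivity) (Finset.sum_le_sum fun i _ => ?_)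
  exact le_add_of_nonneg_left (by positivity)

lemma hsNorm_add_le (A B : Matrix m n ℂ) : hsNorm (A + B) ≤ hsNorm A + hsNorm B := by
  have h (C : Matrix m n ℂ) :
      hsNorm C = ‖(WithLp.toLp 2 (fun q : m × n => C q.1 q.2) : EuclideanSpace ℂ (m × n))‖ := by
    rw [EuclideanSpace.norm_eq, hsNorm, Fintype.sum_prod_type]
  rw [h, h, h]
  exact norm_add_le (WithLp.toLp 2 (fun q : m × n => A q.1 q.2) : EuclideanSpace ℂ (m × n))
    (WithLp.toLp 2 fun q : m × n => B q.1 q.2)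

lemma hsNorm_neg (A : Matrix m n ℂ) : hsNorm (-A) = hsNorm A := by
  simp [hsNorm]

lemma norm_entry_le_one_of_coisometry {m n : Type*} [Fintype n] [DecidableEq m] {A : Matrix m n ℂ} (hA : A * Aᴴ = 1) (i : m)
    (j : n) : ‖A i j‖ ≤ 1 := by
  have h : ∑ j, ‖A i j‖ ^ 2 = 1 := by
    have := congrArg Complex.re (congrFun (congrFun hA i) i)
    simpa [Matrix.mul_apply, Complex.mul_conj, Complex.normSq_eq_norm_sq,
      ← Complex.ofReal_pow] using this
  have h2 : ‖A i j‖ ^ 2 ≤ 1 := h ▸ Finset.single_le_sum (f := fun j => ‖A i j‖ ^ 2)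
    (fun _ _ => by positivity) (Finset.mem_univ j)
  exact (sq_le_one_iff₀ (norm_nonneg _)).1 h2

lemma norm_entry_le_one_of_isometry {m n : Type*} [Fintype m] [DecidableEq n] {A : Matrix m n ℂ} (hA : Aᴴ * A = 1) (i : m)
    (j : n) : ‖A i j‖ ≤ 1 := by
  have := norm_entry_le_one_of_coisometry (A := Aᴴ) (by simpa using hA) j i
  simpa using this

lemma norm_mul_apply_le {m n k : Type*} [Fintype n] (A : Matrix m n ℂ) (B : Matrix n k ℂ) {x y : ℝ} (hx : 0 ≤ x) (i : m)
    (j : k) (hA : ∀ l, ‖A i l‖ ≤ x) (hB : ∀ l, ‖B l j‖ ≤ y) :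
    ‖(A * B) i j‖ ≤ Fintype.card n * (x * y) := by
  rw [Matrix.mul_apply]
  refine (norm_sum_le _ _).trans ?_
  rw [← nsmul_eq_mul]
  refine Finset.sum_le_card_nsmul _ _ _ fun l _ => ?_
  rw [norm_mul]
  exact mul_le_mul (hA l) (hB l) (norm_nonneg _) hx

lemma norm_trace_mul_le (A : Matrix m n ℂ) (B : Matrix n m ℂ) {x y : ℝ} (hx : 0 ≤ x)
    (hA : ∀ i l, ‖A i l‖ ≤ x) (hB : ∀ l i, ‖B l i‖ ≤ y) :
    ‖(A * B).trace‖ ≤ Fintype.card m * (Fintype.card n * (x * y)) := by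
  rw [Matrix.trace]
  refine (norm_sum_le _ _).trans ?_
  rw [← nsmul_eq_mul]
  exact Finset.sum_le_card_nsmul _ _ _ fun i _ =>
    norm_mul_apply_le A B hx i i (hA i) fun l => hB l i

end HSNorm

/-! ### Spectral decompositions and traces of products. -/

section ConjDiag

variable {m n k : Type*} [Fintype m] [Fintype n] [Fintype k]

/-- The matrix `X diag(α) Xᴴ`. -/
noncomputable def conjDiag [DecidableEq n] (X : Matrix m n ℂ) (α : n → ℝ) : Matrix m m ℂ :=
  X * Matrix.diagonal (fun j => (α j : ℂ)) * Xᴴ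

variable [DecidableEq n] [DecidableEq k]

lemma conjDiag_apply {m n : Type*} [Fintype n] [DecidableEq n] (X : Matrix m n ℂ) (α : n → ℝ) (i l : m) :
    conjDiag X α i l = ∑ j, (α j : ℂ) * (X i j * star (X l j)) := by
  rw [conjDiag, Matrix.mul_apply]
  simp only [Matrix.mul_diagonal, Matrix.conjTranspose_apply]
  exact Finset.sum_congr rfl fun j _ => by ring

lemma conjDiag_one {m n : Type*} [Fintype n] [DecidableEq n] (X : Matrix m n ℂ) : conjDiag X 1 = X * Xᴴ := by
  have : (fun j => (((1 : n → ℝ) j : ℝ) : ℂ)) = 1 := by ext; simp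
  rw [conjDiag, this, Matrix.diagonal_one', Matrix.mul_one]

lemma trace_conjDiag_mul (X : Matrix m n ℂ) (Y : Matrix m k ℂ) (α : n → ℝ) (β : k → ℝ) :
    (conjDiag X α * conjDiag Y β).trace.re = ∑ j, ∑ l, α j * β l * ‖(Xᴴ * Y) j l‖ ^ 2 := by
  have h : (conjDiag X α * conjDiag Y β).trace =
      (Matrix.diagonal (fun j => (α j : ℂ)) * (Xᴴ * Y) *
        (Matrix.diagonal (fun j => (β j : ℂ)) * (Xᴴ * Y)ᴴ)).trace := by
    rw [conjDiag, conjDiag, Matrix.mul_assoc, Matrix.mul_assoc, Matrix.trace_mul_comm]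
    simp only [Matrix.conjTranspose_mul, Matrix.conjTranspose_conjTranspose, Matrix.mul_assoc]
  rw [h, Matrix.trace, Complex.re_sum]
  refine Finset.sum_congr rfl fun j _ => ?_
  rw [Matrix.diag_apply, Matrix.mul_apply, Complex.re_sum]
  refine Finset.sum_congr rfl fun l _ => ?_
  rw [Matrix.diagonal_mul, Matrix.diagonal_mul, Matrix.conjTranspose_apply]
  have : (α j : ℂ) * (Xᴴ * Y) j l * ((β l : ℂ) * star ((Xᴴ * Y) j l)) =
      ((α j * β l * ‖(Xᴴ * Y) j l‖ ^ 2 : ℝ) : ℂ) := by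
    have := Complex.mul_conj ((Xᴴ * Y) j l)
    rw [Complex.normSq_eq_norm_sq] at this
    push_cast at this ⊢
    rw [← this]
    simp only [Complex.star_def]
    ring
  rw [this, Complex.ofReal_re]

/-- The trace formula with weight one on `Y`, since `Y * Yᴴ = 1`. It evaluates exactly the linear
terms subtracted in the arithmetic-geometric gap. -/
lemma sum_mul_sum_norm_sq_of_coisometry [DecidableEq m] (X : Matrix m n ℂ) {Y : Matrix m k ℂ}
    (hY : Y * Yᴴ = 1) (α : n → ℝ) :
    ∑ j, ∑ l, α j * ‖(Xᴴ * Y) j l‖ ^ 2 = (conjDiag X α).trace.re := by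
  have := trace_conjDiag_mul X Y α 1
  rw [conjDiag_one, hY, Matrix.mul_one] at this
  simp [this]

lemma sum_mul_sum_norm_sq_of_coisometry' [DecidableEq m] {X : Matrix m n ℂ} (Y : Matrix m k ℂ)
    (hX : X * Xᴴ = 1) (β : k → ℝ) :
    ∑ j, ∑ l, β l * ‖(Xᴴ * Y) j l‖ ^ 2 = (conjDiag Y β).trace.re := by
  have := trace_conjDiag_mul X Y 1 β
  rw [conjDiag_one, hX, Matrix.one_mul] at this
  simp [this]

lemma conjDiag_mul_self {X : Matrix m n ℂ} (hX : Xᴴ * X = 1) (α : n → ℝ) :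
    conjDiag X α * X = X * Matrix.diagonal (fun j => (α j : ℂ)) := by
  rw [conjDiag, Matrix.mul_assoc, hX, Matrix.mul_one]

lemma conjTranspose_mul_conjDiag {X : Matrix m n ℂ} (hX : Xᴴ * X = 1) (α : n → ℝ) :
    Xᴴ * conjDiag X α = Matrix.diagonal (fun j => (α j : ℂ)) * Xᴴ := by
  rw [conjDiag, ← Matrix.mul_assoc, ← Matrix.mul_assoc, hX, Matrix.one_mul]

lemma conjTranspose_mul_conjDiag_mul_self {X : Matrix m n ℂ} (hX : Xᴴ * X = 1) (α : n → ℝ) :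
    Xᴴ * conjDiag X α * X = Matrix.diagonal (fun j => (α j : ℂ)) := by
  rw [conjTranspose_mul_conjDiag hX, Matrix.mul_assoc, hX, Matrix.mul_one]

lemma conjDiag_mul_left {k : Type*} (Z : Matrix k m ℂ) (X : Matrix m n ℂ) (α : n → ℝ) :
    conjDiag (Z * X) α = Z * conjDiag X α * Zᴴ := by
  simp only [conjDiag, Matrix.conjTranspose_mul, Matrix.mul_assoc]

/-- Unitary diagonalization of a Hermitian matrix and of all its powers. -/
lemma exists_unitary_conjDiag {A : Matrix n n ℂ} (hA : A.PosSemidef) :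
    ∃ (W : Matrix n n ℂ) (a : n → ℝ), Wᴴ * W = 1 ∧ W * Wᴴ = 1 ∧ A = conjDiag W a ∧
      (∀ j, 0 ≤ a j) ∧ ∀ s, mpow A s = conjDiag W (fun j => a j ^ s) := by
  refine ⟨hA.1.eigenvectorUnitary, hA.1.eigenvalues, ?_, ?_, ?_, hA.eigenvalues_nonneg, ?_⟩
  · exact Unitary.coe_star_mul_self hA.1.eigenvectorUnitary
  · exact Unitary.coe_mul_star_self hA.1.eigenvectorUnitary
  · conv_lhs => rw [hA.1.spectral_theorem]
    rfl
  · intro s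
    rw [mpow, Matrix.IsHermitian.cfc_eq hA.1]
    rfl

end ConjDiag

/-! ### Scalar inequalities. -/

section Scalar

/-- The geometric mean lies between the harmonic and arithmetic means, whose difference is `s (1 -
s) (a - b)² / (s b + (1 - s) a)`. -/
lemma weighted_arith_sub_geom_le {a b ℓ s : ℝ} (hℓ : 0 < ℓ) (ha : ℓ ≤ a) (hb : ℓ ≤ b) (hs : 0 ≤ s)
    (hs' : s ≤ 1) : |a ^ s * b ^ (1 - s) - s * a - (1 - s) * b| ≤ (a - b) ^ 2 / ℓ := by
  have ha0 := hℓ.trans_le ha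
  have hb0 := hℓ.trans_le hb
  have hD : ℓ ≤ s * b + (1 - s) * a := by nlinarith
  have hD0 := hℓ.trans_le hD
  have h1 := Real.geom_mean_le_arith_mean2_weighted hs (sub_nonneg.2 hs') ha0.le hb0.le (by ring)
  have h2 := Real.geom_mean_le_arith_mean2_weighted hs (sub_nonneg.2 hs') (inv_nonneg.2 ha0.le)
    (inv_nonneg.2 hb0.le) (by ring)
  rw [Real.inv_rpow ha0.le, Real.inv_rpow hb0.le, ← mul_inv] at h2
  have hg : 0 < a ^ s * b ^ (1 - s) := by positivity
  have h3 : a * b / (s * b + (1 - s) * a) ≤ a ^ s * b ^ (1 - s) := by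
    have e : s * a⁻¹ + (1 - s) * b⁻¹ = (a * b / (s * b + (1 - s) * a))⁻¹ := by
      field_simp
    rw [e] at h2
    exact (inv_le_inv₀ hg (by positivity)).1 h2
  have h4 : s * a + (1 - s) * b - a * b / (s * b + (1 - s) * a) =
      s * (1 - s) * (a - b) ^ 2 / (s * b + (1 - s) * a) := by
    rw [eq_div_iff hD0.ne', sub_mul, div_mul_cancel₀ _ hD0.ne']
    ring
  have h5 : s * (1 - s) * (a - b) ^ 2 / (s * b + (1 - s) * a) ≤ (a - b) ^ 2 / ℓ := by
    have : s * (1 - s) ≤ 1 := by nlinarith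
    gcongr
    nlinarith [sq_nonneg (a - b)]
  rw [abs_le]
  constructor
  · linarith
  · have : 0 ≤ (a - b) ^ 2 / ℓ := by positivity
    linarith

lemma abs_weighted_arith_sub_geom_le_one {a b s : ℝ} (ha : 0 ≤ a) (hb : 0 ≤ b) (ha' : a ≤ 1)
    (hb' : b ≤ 1) (hs : 0 ≤ s) (hs' : s ≤ 1) :
    |a ^ s * b ^ (1 - s) - s * a - (1 - s) * b| ≤ 1 := by
  have h1 := Real.geom_mean_le_arith_mean2_weighted hs (sub_nonneg.2 hs') ha hb (by ring)
  have hg : 0 ≤ a ^ s * b ^ (1 - s) := by positivity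
  rw [abs_le]
  constructor <;> nlinarith

/-- By scaling to `d = 1` this is `|t ^ s - 1| ≤ |t - 1|`. The constant is uniform in `s`, and `a =
0` is allowed. -/
lemma abs_rpow_sub_rpow_le {a d s : ℝ} (ha : 0 ≤ a) (hd : 0 < d) (hs : 0 ≤ s) (hs' : s ≤ 1) :
    |a ^ s - d ^ s| ≤ |a - d| * d ^ s / d := by
  have key (t : ℝ) (ht : 0 ≤ t) : |t ^ s - 1| ≤ |t - 1| := by
    rcases le_total t 1 with h | h
    · have h1 : t ^ s ≤ 1 := Real.rpow_le_one ht h hs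
      have h2 : t ≤ t ^ s := by
        rcases ht.eq_or_lt with rfl | h0
        · exact Real.rpow_nonneg le_rfl _
        · simpa using Real.rpow_le_rpow_of_exponent_ge h0 h hs'
      rw [abs_of_nonpos (by linarith), abs_of_nonpos (by linarith)]
      linarith
    · have h1 : 1 ≤ t ^ s := Real.one_le_rpow h hs
      have h2 : t ^ s ≤ t := by simpa using Real.rpow_le_rpow_of_exponent_le h hs'
      rw [abs_of_nonneg (by linarith), abs_of_nonneg (by linarith)]
      linarith
  have h := key (a / d) (by positivity)
  have hds : 0 < d ^ s := by positivity
  have e1 : a ^ s - d ^ s = ((a / d) ^ s - 1) * d ^ s := by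
    rw [Real.div_rpow ha hd.le]; field_simp
  have e2 : |a - d| * d ^ s / d = |a / d - 1| * d ^ s := by
    rw [show a / d - 1 = (a - d) / d by field_simp, abs_div, abs_of_pos hd]; ring
  rw [e1, e2, abs_mul, abs_of_pos hds]
  gcongr

lemma abs_log_one_add_sub_le {x : ℝ} (hx : |x| ≤ 1 / 2) : |Real.log (1 + x) - x| ≤ 2 * x ^ 2 := by
  have hx' := abs_le.1 hx
  have h0 : 0 < 1 + x := by linarith
  have h1 := Real.log_le_sub_one_of_pos h0
  have h2 := Real.one_sub_inv_le_log_of_pos h0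
  have h3 : x - (1 - (1 + x)⁻¹) ≤ 2 * x ^ 2 := by
    have : x - (1 - (1 + x)⁻¹) = x ^ 2 / (1 + x) := by field_simp; ring
    rw [this, div_le_iff₀ h0]
    nlinarith [sq_nonneg x]
  rw [abs_le]
  constructor <;> nlinarith [sq_nonneg x]

end Scalar

end ChernoffPert

/-! ### Eigenvector estimates for one perturbed state. -/

namespace ChernoffPert

open Matrix

/-- Joint spectral data of a state `diag(lam, 0) + N` (eigenvectors `O`, eigenvalues `a`) and of the
block of `N` on the kernel of `diag(lam, 0)` (eigenvectors `F`, eigenvalues `d`), with a spectral gap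
`2 * ℓ` for the unperturbed state, size `ε` of the perturbation, and `d` comparable to `ε`. -/
structure IsSpectralData {n p z : Type*} [Fintype n] [DecidableEq n] [Fintype p] [DecidableEq p]
    [Fintype z] [DecidableEq z] (lam : p → ℝ) (ℓ η ε : ℝ) (N : Matrix (p ⊕ z) (p ⊕ z) ℂ)
    (O : Matrix (p ⊕ z) n ℂ) (a : n → ℝ) (F : Matrix z z ℂ) (d : z → ℝ) : Prop where
  gap_pos : 0 < ℓ
  two_mul_gap_le : ∀ k, 2 * ℓ ≤ lam k
  η_pos : 0 < η
  ε_nonneg : 0 ≤ ε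
  ε_le_one : ε ≤ 1
  hsNorm_le : hsNorm N ≤ ε
  isometry : Oᴴ * O = 1
  coisometry : O * Oᴴ = 1
  conjDiag_eq : conjDiag O a = Matrix.fromBlocks (Matrix.diagonal fun k => (lam k : ℂ)) 0 0 0 + N
  nonneg : ∀ j, 0 ≤ a j
  sum_eq_one : ∑ j, a j = 1
  block_isometry : Fᴴ * F = 1
  block_coisometry : F * Fᴴ = 1
  block_eq : N.toBlocks₂₂ = conjDiag F d
  block_pos : ∀ k, 0 < d k
  le_block : ∀ k, η * ε ≤ d k
  block_le : ∀ k, d k ≤ ε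

namespace IsSpectralData

variable {n p z : Type*} [Fintype n] [DecidableEq n] [Fintype p] [DecidableEq p]
    [Fintype z] [DecidableEq z] {lam : p → ℝ} {ℓ η ε : ℝ} {N : Matrix (p ⊕ z) (p ⊕ z) ℂ}
    {O : Matrix (p ⊕ z) n ℂ} {a : n → ℝ} {F : Matrix z z ℂ} {d : z → ℝ}

lemma le_one (h : IsSpectralData lam ℓ η ε N O a F d) (j : n) : a j ≤ 1 :=
  h.sum_eq_one ▸ Finset.single_le_sum (fun j _ => h.nonneg j) (Finset.mem_univ j)

lemma block_le_one (h : IsSpectralData lam ℓ η ε N O a F d) (k : z) : d k ≤ 1 :=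
  (h.block_le k).trans h.ε_le_one

/-- Entrywise eigenvalue equation: `(a j - λ i) O i j = (N O) i j`, with `λ = lam` on `p` and `0` on
`z`. With the gap it forces eigenvectors to be `O(ε)` in the block they do not belong to. -/
lemma abs_sub_mul_norm_le (h : IsSpectralData lam ℓ η ε N O a F d) (i : p ⊕ z) (j : n) :
    |a j - Sum.elim lam 0 i| * ‖O i j‖ ≤ ε := by
  have hD : Matrix.fromBlocks (Matrix.diagonal fun k => (lam k : ℂ)) 0 0 (0 : Matrix z z ℂ) =
      Matrix.diagonal (fun i => ((Sum.elim lam 0 i : ℝ) : ℂ)) := by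
    rw [← Matrix.diagonal_zero, Matrix.fromBlocks_diagonal]
    congr 1
    ext (i | i) <;> simp
  have e := conjDiag_mul_self h.isometry a
  rw [h.conjDiag_eq, hD, Matrix.add_mul] at e
  have e2 := congrFun (congrFun e i) j
  rw [Matrix.add_apply, Matrix.diagonal_mul, Matrix.mul_diagonal] at e2
  have e3 : ((a j - Sum.elim lam 0 i : ℝ) : ℂ) * O i j = (N * O) i j := by
    push_cast
    linear_combination -e2
  calc |a j - Sum.elim lam 0 i| * ‖O i j‖ = ‖(N * O) i j‖ := by
        rw [← e3, norm_mul, Complex.norm_real, Real.norm_eq_abs]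
    _ ≤ hsNorm (N * O) := norm_entry_le_hsNorm _ _ _
    _ = hsNorm N := hsNorm_mul_of_coisometry _ h.coisometry
    _ ≤ ε := h.hsNorm_le

lemma norm_inl_le (h : IsSpectralData lam ℓ η ε N O a F d) (i : p) {j : n} (hj : a j ≤ ℓ) :
    ‖O (Sum.inl i) j‖ ≤ ε / ℓ := by
  rw [le_div_iff₀ h.gap_pos, mul_comm]
  refine le_trans ?_ (h.abs_sub_mul_norm_le (Sum.inl i) j)
  have := h.two_mul_gap_le i
  gcongr
  rw [abs_sub_comm, Sum.elim_inl]
  exact le_trans (by linarith) (le_abs_self _)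

lemma norm_inr_le (h : IsSpectralData lam ℓ η ε N O a F d) (i : z) {j : n} (hj : ℓ ≤ a j) :
    ‖O (Sum.inr i) j‖ ≤ ε / ℓ := by
  rw [le_div_iff₀ h.gap_pos, mul_comm]
  refine le_trans ?_ (h.abs_sub_mul_norm_le (Sum.inr i) j)
  gcongr
  rw [Sum.elim_inr]
  exact le_trans (by simpa using hj) (le_abs_self _)

lemma toRows₂_coisometry (h : IsSpectralData lam ℓ η ε N O a F d) :
    O.toRows₂ * O.toRows₂ᴴ = 1 := by
  ext i j
  have := congrFun (congrFun h.coisometry (Sum.inr i)) (Sum.inr j)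
  simpa [Matrix.mul_apply, Matrix.one_apply] using this

lemma conjDiag_toRows₂ (h : IsSpectralData lam ℓ η ε N O a F d) :
    conjDiag O.toRows₂ a = N.toBlocks₂₂ := by
  ext i j
  have := congrFun (congrFun h.conjDiag_eq (Sum.inr i)) (Sum.inr j)
  rw [conjDiag_apply] at this ⊢
  simpa [Matrix.toBlocks₂₂] using this

lemma overlap_coisometry (h : IsSpectralData lam ℓ η ε N O a F d) :
    (Fᴴ * O.toRows₂) * (Fᴴ * O.toRows₂)ᴴ = 1 := by
  rw [Matrix.conjTranspose_mul, Matrix.mul_assoc, ← Matrix.mul_assoc O.toRows₂,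
    h.toRows₂_coisometry, Matrix.one_mul, Matrix.conjTranspose_conjTranspose, h.block_isometry]

lemma norm_overlap_le_one (h : IsSpectralData lam ℓ η ε N O a F d) (k : z) (j : n) :
    ‖(Fᴴ * O.toRows₂) k j‖ ≤ 1 := norm_entry_le_one_of_coisometry h.overlap_coisometry k j

lemma norm_conjTranspose_block_le_one (h : IsSpectralData lam ℓ η ε N O a F d) (k l : z) :
    ‖Fᴴ k l‖ ≤ 1 := by
  simpa using norm_entry_le_one_of_isometry h.block_isometry l k

lemma norm_overlap_le_of_le (h : IsSpectralData lam ℓ η ε N O a F d) (k : z) {j : n}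
    (hj : ℓ ≤ a j) : ‖(Fᴴ * O.toRows₂) k j‖ ≤ Fintype.card z * (1 * (ε / ℓ)) :=
  norm_mul_apply_le _ _ zero_le_one k j (h.norm_conjTranspose_block_le_one k) fun l =>
    h.norm_inr_le l hj

lemma sub_mul_overlap (h : IsSpectralData lam ℓ η ε N O a F d) (k : z) (j : n) :
    ((a j - d k : ℝ) : ℂ) * (Fᴴ * O.toRows₂) k j = (Fᴴ * N.toBlocks₂₁ * O.toRows₁) k j := by
  have e : O.toRows₂ * Matrix.diagonal (fun j => (a j : ℂ)) =
      N.toBlocks₂₁ * O.toRows₁ + N.toBlocks₂₂ * O.toRows₂ := by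
    ext i j
    have := congrFun (congrFun (conjDiag_mul_self h.isometry a) (Sum.inr i)) j
    rw [h.conjDiag_eq, Matrix.mul_apply, Fintype.sum_sum_type, Matrix.mul_diagonal] at this
    rw [Matrix.mul_diagonal]
    simpa [Matrix.mul_apply, Matrix.toBlocks₂₁, Matrix.toBlocks₂₂] using this.symm
  have e2 := congrArg (Fᴴ * ·) e
  simp only [Matrix.mul_add, ← Matrix.mul_assoc] at e2
  rw [h.block_eq, conjTranspose_mul_conjDiag h.block_isometry] at e2
  have e3 := congrFun (congrFun e2 k) j
  rw [Matrix.mul_diagonal, Matrix.add_apply, Matrix.mul_assoc (Matrix.diagonal _),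
    Matrix.diagonal_mul] at e3
  push_cast
  linear_combination e3

/-- In the eigenbasis of the kernel block, only the off-diagonal block of `N` acting on the support
components of the eigenvector remains: two factors of order `ε`. -/
lemma abs_sub_mul_norm_overlap_le (h : IsSpectralData lam ℓ η ε N O a F d) (k : z) {j : n}
    (hj : a j ≤ ℓ) : |a j - d k| * ‖(Fᴴ * O.toRows₂) k j‖ ≤
      Fintype.card p * Fintype.card z / ℓ * ε ^ 2 := by
  have e := congrArg norm (h.sub_mul_overlap k j)
  rw [norm_mul, Complex.norm_real, Real.norm_eq_abs] at e
  rw [e]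
  have hε := h.ε_nonneg
  have h1 (l : p) : ‖(Fᴴ * N.toBlocks₂₁) k l‖ ≤ Fintype.card z * (1 * ε) :=
    norm_mul_apply_le _ _ zero_le_one k l (h.norm_conjTranspose_block_le_one k) fun i =>
      (norm_entry_le_hsNorm N (Sum.inr i) (Sum.inl l)).trans h.hsNorm_le
  refine (norm_mul_apply_le _ _ (by positivity) k j h1 fun l => h.norm_inl_le l hj).trans
    (le_of_eq ?_)
  ring

/-- If `a j = 0`, then `d k ≥ η ε` makes all overlaps with the kernel block `O(ε)`, and the support
components are `O(ε)` as well, which contradicts unit length for small `ε`. -/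
lemma pos (h : IsSpectralData lam ℓ η ε N O a F d)
    (hε : (Fintype.card p + Fintype.card z : ℝ) *
      (1 / ℓ + Fintype.card z * (Fintype.card p * Fintype.card z / (ℓ * η))) ^ 2 * ε < 1) (j : n) :
    0 < a j := by
  refine (h.nonneg j).lt_of_ne' fun h0 => ?_
  have hℓ := h.gap_pos
  have hη := h.η_pos
  have hε0 := h.ε_nonneg
  have hj : a j ≤ ℓ := h0 ▸ hℓ.le
  set M : ℝ := 1 / ℓ + Fintype.card z * (Fintype.card p * Fintype.card z / (ℓ * η)) with hM
  have ho (k : z) : ‖(Fᴴ * O.toRows₂) k j‖ ≤ Fintype.card p * Fintype.card z / (ℓ * η) * ε := by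
    have hd := h.block_pos k
    have hεpos : 0 < ε := hd.trans_le (h.block_le k)
    have h1 := h.abs_sub_mul_norm_overlap_le k hj
    rw [h0, zero_sub, abs_neg, abs_of_pos hd] at h1
    have h2 : η * ε * ‖(Fᴴ * O.toRows₂) k j‖ ≤ Fintype.card p * Fintype.card z / ℓ * ε ^ 2 :=
      le_trans (by gcongr; exact h.le_block k) h1
    have h3 : (Fintype.card p * Fintype.card z / ℓ * ε ^ 2 : ℝ) =
        η * ε * (Fintype.card p * Fintype.card z / (ℓ * η) * ε) := by
      field_simp
    rw [h3] at h2
    exact le_of_mul_le_mul_left h2 (by positivity)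
  have hz : O.toRows₂ = F * (Fᴴ * O.toRows₂) := by
    rw [← Matrix.mul_assoc, h.block_coisometry, Matrix.one_mul]
  have hO (i : p ⊕ z) : ‖O i j‖ ≤ M * ε := by
    rcases i with i | i
    · refine (h.norm_inl_le i hj).trans ?_
      rw [hM, add_mul, one_div_mul_eq_div]
      exact le_add_of_nonneg_right (by positivity)
    · have h1 : ‖O.toRows₂ i j‖ ≤ Fintype.card z *
          (1 * (Fintype.card p * Fintype.card z / (ℓ * η) * ε)) := by
        rw [hz]
        exact norm_mul_apply_le F _ zero_le_one i j
          (norm_entry_le_one_of_isometry h.block_isometry i) fun k => ho k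
      refine h1.trans ?_
      rw [hM, add_mul, one_mul, mul_assoc]
      exact le_add_of_nonneg_left (by positivity)
  have h1 : ∑ i, ‖O i j‖ ^ 2 = 1 := by
    have := congrArg Complex.re (congrFun (congrFun h.isometry j) j)
    simpa [Matrix.mul_apply, ← Complex.normSq_eq_conj_mul_self, Complex.normSq_eq_norm_sq,
      -Complex.ofReal_pow, ← Complex.ofReal_pow] using this
  have h2 : ∑ i, ‖O i j‖ ^ 2 ≤ Fintype.card (p ⊕ z) • (M * ε) ^ 2 :=
    Finset.sum_le_card_nsmul _ _ _ fun i _ => by gcongr; exact hO i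
  rw [h1, nsmul_eq_mul, Fintype.card_sum] at h2
  push_cast at h2
  have h3 : (Fintype.card p + Fintype.card z : ℝ) * (M * ε) ^ 2 ≤
      (Fintype.card p + Fintype.card z : ℝ) * M ^ 2 * ε := by
    have : ε ^ 2 ≤ ε := by nlinarith [h.ε_le_one]
    rw [mul_pow, ← mul_assoc]
    gcongr
  linarith

/-- The power of the perturbed state, compressed to the kernel block, differs from the power of the
block by a quantity which is small relative to `ε ^ s`. -/
lemma norm_conjDiag_sub_apply_le (h : IsSpectralData lam ℓ η ε N O a F d) {s : ℝ} (hs : 0 ≤ s)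
    (hs' : s ≤ 1) (i l : z) :
    ‖(conjDiag O.toRows₂ (fun j => a j ^ s) - conjDiag F (fun k => d k ^ s)) i l‖ ≤
      Fintype.card z ^ 2 * (Fintype.card n * (Fintype.card p * Fintype.card z / (ℓ * η) +
        (Fintype.card z / ℓ) ^ 2)) * (ε * ε ^ s) := by
  have hℓ := h.gap_pos
  have hη := h.η_pos
  have hε0 := h.ε_nonneg
  set o := Fᴴ * O.toRows₂ with ho
  set E := conjDiag O.toRows₂ (fun j => a j ^ s) - conjDiag F (fun k => d k ^ s) with hE
  set B : ℝ := Fintype.card p * Fintype.card z / (ℓ * η) + (Fintype.card z / ℓ) ^ 2 with hB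
  have hFE : Fᴴ * E * F = conjDiag o (fun j => a j ^ s) -
      Matrix.diagonal (fun k => ((d k ^ s : ℝ) : ℂ)) := by
    rw [hE, Matrix.mul_sub, Matrix.sub_mul, conjTranspose_mul_conjDiag_mul_self h.block_isometry,
      ho, conjDiag_mul_left, Matrix.conjTranspose_conjTranspose]
  have hEF : E = F * (Fᴴ * E * F) * Fᴴ := by
    rw [← Matrix.mul_assoc, ← Matrix.mul_assoc, h.block_coisometry, Matrix.one_mul,
      Matrix.mul_assoc, h.block_coisometry, Matrix.mul_one]
  have key (k k' : z) : ‖(Fᴴ * E * F) k k'‖ ≤ Fintype.card n * (B * (ε * ε ^ s)) := by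
    have hd := h.block_pos k
    have hεpos : 0 < ε := hd.trans_le (h.block_le k)
    have hεs : ε ≤ ε ^ s := by
      simpa using Real.rpow_le_rpow_of_exponent_ge hεpos h.ε_le_one hs'
    -- The rows of `o` are orthonormal, so the diagonal term can be spread over the same sum, giving
    -- the differences `a j ^ s - d k ^ s`.
    have e : (Fᴴ * E * F) k k' =
        ∑ j, ((a j ^ s - d k ^ s : ℝ) : ℂ) * (o k j * star (o k' j)) := by
      have h1 : Matrix.diagonal (fun k => ((d k ^ s : ℝ) : ℂ)) k k' =
          ∑ j, ((d k ^ s : ℝ) : ℂ) * (o k j * star (o k' j)) := by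
        have h2 := congrFun (congrFun h.overlap_coisometry k) k'
        rw [Matrix.mul_apply] at h2
        simp only [Matrix.conjTranspose_apply] at h2
        rw [← Finset.mul_sum, h2, Matrix.diagonal_apply, Matrix.one_apply]
        simp
      rw [hFE, Matrix.sub_apply, conjDiag_apply, h1, ← Finset.sum_sub_distrib]
      refine Finset.sum_congr rfl fun j _ => ?_
      push_cast
      ring
    rw [e]
    refine (norm_sum_le _ _).trans ?_
    rw [← nsmul_eq_mul]
    refine Finset.sum_le_card_nsmul _ _ _ fun j _ => ?_
    rw [norm_mul, norm_mul, norm_star, Complex.norm_real, Real.norm_eq_abs]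
    have hds : 0 ≤ d k ^ s := by positivity
    have hB1 : 0 ≤ (Fintype.card p * Fintype.card z / (ℓ * η) : ℝ) := by positivity
    have hB2 : 0 ≤ ((Fintype.card z / ℓ) ^ 2 : ℝ) := by positivity
    have hεε : 0 ≤ ε * ε ^ s := by positivity
    rcases le_total (a j) ℓ with hj | hj
    -- Small eigenvalue: one overlap absorbs `|a j - d k|` to give `ε²`, and dividing by `d k ≥ η ε`
    -- leaves `ε * ε ^ s`.
    · calc |a j ^ s - d k ^ s| * (‖o k j‖ * ‖o k' j‖)
          ≤ (|a j - d k| * d k ^ s / d k) * (‖o k j‖ * 1) := by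
            gcongr
            · exact abs_rpow_sub_rpow_le (h.nonneg j) hd hs hs'
            · exact h.norm_overlap_le_one k' j
        _ = (|a j - d k| * ‖o k j‖) * (d k ^ s / d k) := by ring
        _ ≤ (Fintype.card p * Fintype.card z / ℓ * ε ^ 2) * (ε ^ s / (η * ε)) := by
            refine mul_le_mul (h.abs_sub_mul_norm_overlap_le k hj) ?_ (by positivity)
              (by positivity)
            exact div_le_div₀ (by positivity) (Real.rpow_le_rpow hd.le (h.block_le k) hs)
              (by positivity) (h.le_block k)
        _ = Fintype.card p * Fintype.card z / (ℓ * η) * (ε * ε ^ s) := by field_simp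
        _ ≤ B * (ε * ε ^ s) := by
            rw [hB]
            gcongr
            exact le_add_of_nonneg_right hB2
    -- Large eigenvalue: both overlaps are `O(ε)`, and `ε² ≤ ε * ε ^ s`.
    · have h1 : |a j ^ s - d k ^ s| ≤ 1 := by
        have h2 := Real.rpow_le_one (h.nonneg j) (h.le_one j) hs
        have h3 := Real.rpow_le_one hd.le (h.block_le_one k) hs
        have h4 := Real.rpow_nonneg (h.nonneg j) s
        rw [abs_le]
        constructor <;> linarith
      calc |a j ^ s - d k ^ s| * (‖o k j‖ * ‖o k' j‖)
          ≤ 1 * ((Fintype.card z * (1 * (ε / ℓ))) * (Fintype.card z * (1 * (ε / ℓ)))) := by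
            gcongr
            · exact h.norm_overlap_le_of_le k hj
            · exact h.norm_overlap_le_of_le k' hj
        _ = (Fintype.card z / ℓ) ^ 2 * (ε * ε) := by ring
        _ ≤ (Fintype.card z / ℓ) ^ 2 * (ε * ε ^ s) := by gcongr
        _ ≤ B * (ε * ε ^ s) := by
            rw [hB]
            gcongr
            exact le_add_of_nonneg_left hB1
  have hB0 : 0 ≤ B := by positivity
  have h1 (k : z) : ‖(F * (Fᴴ * E * F)) i k‖ ≤
      Fintype.card z * (1 * (Fintype.card n * (B * (ε * ε ^ s)))) :=
    norm_mul_apply_le F _ zero_le_one i k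
      (norm_entry_le_one_of_isometry h.block_isometry i) fun l => key l k
  rw [hEF]
  refine (norm_mul_apply_le _ Fᴴ (by positivity) i l h1 fun k =>
    h.norm_conjTranspose_block_le_one k l).trans (le_of_eq ?_)
  ring

lemma norm_conjDiag_block_apply_le (h : IsSpectralData lam ℓ η ε N O a F d) {s : ℝ} (hs : 0 ≤ s)
    (i l : z) : ‖conjDiag F (fun k => d k ^ s) i l‖ ≤ Fintype.card z * ε ^ s := by
  rw [conjDiag_apply]
  refine (norm_sum_le _ _).trans ?_
  rw [← nsmul_eq_mul]
  refine Finset.sum_le_card_nsmul _ _ _ fun k _ => ?_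
  have hd := (h.block_pos k).le
  rw [norm_mul, norm_mul, norm_star, Complex.norm_real, Real.norm_of_nonneg (by positivity)]
  have := Real.rpow_le_rpow hd (h.block_le k) hs
  have hε := Real.rpow_nonneg h.ε_nonneg s
  calc d k ^ s * (‖F i k‖ * ‖F l k‖) ≤ ε ^ s * (1 * 1) := by
        gcongr <;> exact norm_entry_le_one_of_isometry h.block_isometry _ _
    _ = ε ^ s := by ring

end IsSpectralData

end ChernoffPert

/-! ### Comparison of two perturbed states. -/

namespace ChernoffPert

open Matrix

namespace IsSpectralData

variable {n p z : Type*} [Fintype n] [DecidableEq n] [Fintype p] [DecidableEq p]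
    [Fintype z] [DecidableEq z] {lam : p → ℝ} {ℓ η ε ε₁ ε₂ : ℝ}
    {N₁ N₂ : Matrix (p ⊕ z) (p ⊕ z) ℂ} {O₁ O₂ : Matrix (p ⊕ z) n ℂ} {a b : n → ℝ}
    {F₁ F₂ : Matrix z z ℂ} {d e : z → ℝ}

/-- The unperturbed parts cancel in the difference of the two states, so its matrix elements between
the two eigenbases involve only `N₁ - N₂`. -/
lemma abs_sub_mul_norm_eigenvector_overlap_le (h₁ : IsSpectralData lam ℓ η ε₁ N₁ O₁ a F₁ d)
    (h₂ : IsSpectralData lam ℓ η ε₂ N₂ O₂ b F₂ e) (j l : n) :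
    |a j - b l| * ‖(O₁ᴴ * O₂) j l‖ ≤ ε₁ + ε₂ := by
  have key : O₁ᴴ * (N₁ - N₂) * O₂ = Matrix.diagonal (fun j => (a j : ℂ)) * (O₁ᴴ * O₂) -
      (O₁ᴴ * O₂) * Matrix.diagonal (fun j => (b j : ℂ)) := by
    rw [show N₁ - N₂ = conjDiag O₁ a - conjDiag O₂ b by rw [h₁.conjDiag_eq, h₂.conjDiag_eq]; abel,
      Matrix.mul_sub, Matrix.sub_mul, conjTranspose_mul_conjDiag h₁.isometry, Matrix.mul_assoc,
      Matrix.mul_assoc, conjDiag_mul_self h₂.isometry, ← Matrix.mul_assoc O₁ᴴ]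
  have e1 := congrFun (congrFun key j) l
  rw [Matrix.sub_apply, Matrix.diagonal_mul, Matrix.mul_diagonal] at e1
  have e2 : ((a j - b l : ℝ) : ℂ) * (O₁ᴴ * O₂) j l = (O₁ᴴ * (N₁ - N₂) * O₂) j l := by
    rw [e1]; push_cast; ring
  calc |a j - b l| * ‖(O₁ᴴ * O₂) j l‖ = ‖(O₁ᴴ * (N₁ - N₂) * O₂) j l‖ := by
        rw [← e2, norm_mul, Complex.norm_real, Real.norm_eq_abs]
    _ ≤ hsNorm (O₁ᴴ * (N₁ - N₂) * O₂) := norm_entry_le_hsNorm _ _ _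
    _ = hsNorm (N₁ + -N₂) := by
        rw [hsNorm_mul_of_coisometry _ h₂.coisometry, hsNorm_mul_of_isometry _
          (by rw [Matrix.conjTranspose_conjTranspose, h₁.coisometry]), sub_eq_add_neg]
    _ ≤ hsNorm N₁ + hsNorm (-N₂) := hsNorm_add_le _ _
    _ ≤ ε₁ + ε₂ := by
        rw [hsNorm_neg]
        exact add_le_add h₁.hsNorm_le h₂.hsNorm_le

lemma conjTranspose_mul_eq_add {n p z : Type*} [Fintype p] [Fintype z] (O₁ O₂ : Matrix (p ⊕ z) n ℂ) :
    O₁ᴴ * O₂ = O₁.toRows₁ᴴ * O₂.toRows₁ + O₁.toRows₂ᴴ * O₂.toRows₂ := by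
  ext i j
  simp [Matrix.mul_apply]

lemma norm_eigenvector_overlap_le_one (h₁ : IsSpectralData lam ℓ η ε₁ N₁ O₁ a F₁ d)
    (h₂ : IsSpectralData lam ℓ η ε₂ N₂ O₂ b F₂ e) (j l : n) : ‖(O₁ᴴ * O₂) j l‖ ≤ 1 := by
  refine norm_entry_le_one_of_coisometry ?_ j l
  rw [Matrix.conjTranspose_mul, Matrix.conjTranspose_conjTranspose, Matrix.mul_assoc,
    ← Matrix.mul_assoc O₂, h₂.coisometry, Matrix.one_mul, h₁.isometry]

/-- Weighted by the arithmetic-geometric mean gap of two eigenvalues, the overlap of their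
eigenvectors is carried by the kernel block up to second order. -/
lemma abs_overlap_sub_mul_gap_le (h₁ : IsSpectralData lam ℓ η ε₁ N₁ O₁ a F₁ d)
    (h₂ : IsSpectralData lam ℓ η ε₂ N₂ O₂ b F₂ e) (hε : ε ≤ 1) (hε₁ : ε₁ ≤ ε) (hε₂ : ε₂ ≤ ε)
    {s : ℝ} (hs : 0 ≤ s) (hs' : s ≤ 1) (j l : n) :
    |(‖(O₁ᴴ * O₂) j l‖ ^ 2 - ‖(O₁.toRows₂ᴴ * O₂.toRows₂) j l‖ ^ 2) *
        (a j ^ s * b l ^ (1 - s) - s * a j - (1 - s) * b l)| ≤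
      (Fintype.card p * (1 + Fintype.card z) / ℓ ^ 2 +
        (((Fintype.card p + Fintype.card z) / ℓ) ^ 2 + (Fintype.card z / ℓ) ^ 2) +
        (4 / ℓ + (Fintype.card z / ℓ ^ 2) ^ 2)) * ε ^ 2 := by
  have hℓ := h₁.gap_pos
  have hε0 : 0 ≤ ε := h₁.ε_nonneg.trans hε₁
  set P : ℝ := (Fintype.card p : ℝ) with hP
  set Z : ℝ := (Fintype.card z : ℝ) with hZ
  have hP0 : 0 ≤ P := by positivity
  have hZ0 : 0 ≤ Z := by positivity
  set x := (O₁ᴴ * O₂) j l with hx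
  set y := (O₁.toRows₂ᴴ * O₂.toRows₂) j l with hy
  set u := (O₁.toRows₁ᴴ * O₂.toRows₁) j l with hu
  set g := a j ^ s * b l ^ (1 - s) - s * a j - (1 - s) * b l with hg
  have hxuy : x = u + y := by
    rw [hx, conjTranspose_mul_eq_add, Matrix.add_apply]
  have hx1 : ‖x‖ ≤ 1 := h₁.norm_eigenvector_overlap_le_one h₂ j l
  have hg1 : |g| ≤ 1 := abs_weighted_arith_sub_geom_le_one (h₁.nonneg j) (h₂.nonneg l)
    (h₁.le_one j) (h₂.le_one l) hs hs'
  have hO₁ (i : p ⊕ z) : ‖O₁ i j‖ ≤ 1 := norm_entry_le_one_of_isometry h₁.isometry i j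
  have hO₂ (i : p ⊕ z) : ‖O₂ i l‖ ≤ 1 := norm_entry_le_one_of_isometry h₂.isometry i l
  have hub {α β : ℝ} (hα : 0 ≤ α) (h₁ : ∀ i, ‖O₁ (Sum.inl i) j‖ ≤ α)
      (h₂ : ∀ i, ‖O₂ (Sum.inl i) l‖ ≤ β) : ‖u‖ ≤ P * (α * β) :=
    norm_mul_apply_le _ _ hα j l (fun i => by simpa using h₁ i) h₂
  have hyb {α β : ℝ} (hα : 0 ≤ α) (h₁ : ∀ i, ‖O₁ (Sum.inr i) j‖ ≤ α)
      (h₂ : ∀ i, ‖O₂ (Sum.inr i) l‖ ≤ β) : ‖y‖ ≤ Z * (α * β) :=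
    norm_mul_apply_le _ _ hα j l (fun i => by simpa using h₁ i) h₂
  have hεℓ : 0 ≤ ε / ℓ := by positivity
  have hε₁ℓ : ε₁ / ℓ ≤ ε / ℓ := by gcongr
  have hε₂ℓ : ε₂ / ℓ ≤ ε / ℓ := by gcongr
  have mixed (hu' : ‖u‖ ≤ P * (ε / ℓ)) (hy' : ‖y‖ ≤ Z * (ε / ℓ)) :
      |(‖x‖ ^ 2 - ‖y‖ ^ 2) * g| ≤ (((P + Z) / ℓ) ^ 2 + (Z / ℓ) ^ 2) * ε ^ 2 := by
    have hx' : ‖x‖ ≤ (P + Z) / ℓ * ε := by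
      rw [hxuy]
      refine (norm_add_le _ _).trans ((add_le_add hu' hy').trans (le_of_eq ?_))
      ring
    have hx2 : ‖x‖ ^ 2 ≤ ((P + Z) / ℓ) ^ 2 * ε ^ 2 := by
      rw [← mul_pow]; gcongr
    have hy2 : ‖y‖ ^ 2 ≤ (Z / ℓ) ^ 2 * ε ^ 2 := by
      rw [← mul_pow, show Z / ℓ * ε = Z * (ε / ℓ) by ring]; gcongr
    rw [abs_mul]
    calc |‖x‖ ^ 2 - ‖y‖ ^ 2| * |g| ≤ |‖x‖ ^ 2 - ‖y‖ ^ 2| * 1 := by gcongr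
      _ ≤ ‖x‖ ^ 2 + ‖y‖ ^ 2 := by
          rw [mul_one, abs_le]
          constructor <;> nlinarith [sq_nonneg ‖x‖, sq_nonneg ‖y‖]
      _ ≤ _ := by linarith
  have hS : 0 ≤ P * (1 + Z) / ℓ ^ 2 * ε ^ 2 := by positivity
  have hM : 0 ≤ (((P + Z) / ℓ) ^ 2 + (Z / ℓ) ^ 2) * ε ^ 2 := by positivity
  have hB : 0 ≤ (4 / ℓ + (Z / ℓ ^ 2) ^ 2) * ε ^ 2 := by positivity
  rw [add_mul, add_mul]
  -- Only when both eigenvalues are large can `x` be of order one while `y` is negligible; there the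
  -- smallness comes from `g ≲ (a - b)²` together with `|a - b| ‖x‖ ≤ 2ε`.
  rcases le_total (a j) ℓ with hj | hj <;> rcases le_total (b l) ℓ with hl | hl
  · have hu' : ‖u‖ ≤ P * (ε / ℓ * (ε / ℓ)) :=
      hub hεℓ (fun i => (h₁.norm_inl_le i hj).trans hε₁ℓ)
        fun i => (h₂.norm_inl_le i hl).trans hε₂ℓ
    have hy' : ‖y‖ ≤ Z := by
      simpa using hyb zero_le_one (fun i => hO₁ _) fun i => hO₂ _
    have h3 : |‖x‖ - ‖y‖| ≤ ‖u‖ := by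
      have := abs_norm_sub_norm_le x y
      rwa [hxuy, add_sub_cancel_right, ← hxuy] at this
    have h4 : |(‖x‖ ^ 2 - ‖y‖ ^ 2) * g| ≤ P * (1 + Z) / ℓ ^ 2 * ε ^ 2 := by
      rw [sq_sub_sq, abs_mul, abs_mul, abs_of_nonneg (by positivity : 0 ≤ ‖x‖ + ‖y‖)]
      calc (‖x‖ + ‖y‖) * |‖x‖ - ‖y‖| * |g| ≤ (1 + Z) * (P * (ε / ℓ * (ε / ℓ))) * 1 := by
            gcongr
            exact h3.trans hu'
        _ = _ := by ring
    linarith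
  · have := mixed (by simpa using hub hεℓ (fun i => (h₁.norm_inl_le i hj).trans hε₁ℓ) fun i => hO₂ _)
      (by simpa using hyb zero_le_one (fun i => hO₁ _) fun i => (h₂.norm_inr_le i hl).trans hε₂ℓ)
    linarith
  · have := mixed
      (by simpa using hub zero_le_one (fun i => hO₁ _) fun i => (h₂.norm_inl_le i hl).trans hε₂ℓ)
      (by simpa using hyb hεℓ (fun i => (h₁.norm_inr_le i hj).trans hε₁ℓ) fun i => hO₂ _)
    linarith
  · have hy' : ‖y‖ ≤ Z * (ε / ℓ * (ε / ℓ)) :=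
      hyb hεℓ (fun i => (h₁.norm_inr_le i hj).trans hε₁ℓ)
        fun i => (h₂.norm_inr_le i hl).trans hε₂ℓ
    have hy2 : ‖y‖ ^ 2 * |g| ≤ (Z / ℓ ^ 2) ^ 2 * ε ^ 2 := by
      calc ‖y‖ ^ 2 * |g| ≤ (Z * (ε / ℓ * (ε / ℓ))) ^ 2 * 1 := by gcongr
        _ = (Z / ℓ ^ 2) ^ 2 * (ε ^ 2 * ε ^ 2) := by ring
        _ ≤ (Z / ℓ ^ 2) ^ 2 * (ε ^ 2 * 1) := by
            gcongr
            exact pow_le_one₀ hε0 hε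
        _ = _ := by ring
    have hx2 : ‖x‖ ^ 2 * |g| ≤ 4 / ℓ * ε ^ 2 := by
      have h5 : |a j - b l| * ‖x‖ ≤ 2 * ε :=
        (h₁.abs_sub_mul_norm_eigenvector_overlap_le h₂ j l).trans (by linarith)
      calc ‖x‖ ^ 2 * |g| ≤ ‖x‖ ^ 2 * ((a j - b l) ^ 2 / ℓ) := by
            gcongr
            exact weighted_arith_sub_geom_le hℓ hj hl hs hs'
        _ = (|a j - b l| * ‖x‖) ^ 2 / ℓ := by rw [mul_pow, sq_abs]; ring
        _ ≤ (2 * ε) ^ 2 / ℓ := by gcongr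
        _ = 4 / ℓ * ε ^ 2 := by ring
    have h6 : |(‖x‖ ^ 2 - ‖y‖ ^ 2) * g| ≤ ‖x‖ ^ 2 * |g| + ‖y‖ ^ 2 * |g| := by
      rw [abs_mul, ← add_mul]
      gcongr
      rw [abs_le]
      constructor <;> nlinarith [sq_nonneg ‖x‖, sq_nonneg ‖y‖]
    linarith

lemma trace_re_conjDiag (h : IsSpectralData lam ℓ η ε N₁ O₁ a F₁ d) :
    (conjDiag O₁ a).trace.re = 1 := by
  rw [conjDiag, Matrix.trace_mul_comm, ← Matrix.mul_assoc, h.isometry, Matrix.one_mul,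
    Matrix.trace_diagonal, ← Complex.ofReal_sum, Complex.ofReal_re, h.sum_eq_one]

/-- Exact comparison of the trace of the product of powers with the one of the kernel blocks. -/
lemma sum_overlap_sub_mul_gap (h₁ : IsSpectralData lam ℓ η ε₁ N₁ O₁ a F₁ d)
    (h₂ : IsSpectralData lam ℓ η ε₂ N₂ O₂ b F₂ e) (s : ℝ) :
    ∑ j, ∑ l, (‖(O₁ᴴ * O₂) j l‖ ^ 2 - ‖(O₁.toRows₂ᴴ * O₂.toRows₂) j l‖ ^ 2) *
        (a j ^ s * b l ^ (1 - s) - s * a j - (1 - s) * b l) =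
      (conjDiag O₁ (fun j => a j ^ s) * conjDiag O₂ (fun j => b j ^ (1 - s))).trace.re - 1 -
      ((conjDiag O₁.toRows₂ (fun j => a j ^ s) *
          conjDiag O₂.toRows₂ (fun j => b j ^ (1 - s))).trace.re -
        s * N₁.toBlocks₂₂.trace.re - (1 - s) * N₂.toBlocks₂₂.trace.re) := by
  have e1 := sum_mul_sum_norm_sq_of_coisometry O₁ h₂.coisometry a
  have e2 := sum_mul_sum_norm_sq_of_coisometry' O₂ h₁.coisometry b
  have e3 := sum_mul_sum_norm_sq_of_coisometry O₁.toRows₂ h₂.toRows₂_coisometry a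
  have e4 := sum_mul_sum_norm_sq_of_coisometry' O₂.toRows₂ h₁.toRows₂_coisometry b
  rw [h₁.trace_re_conjDiag] at e1
  rw [h₂.trace_re_conjDiag] at e2
  rw [h₁.conjDiag_toRows₂] at e3
  rw [h₂.conjDiag_toRows₂] at e4
  have split (w : n → n → ℝ) : ∑ j, ∑ l, w j l *
      (a j ^ s * b l ^ (1 - s) - s * a j - (1 - s) * b l) =
      ∑ j, ∑ l, a j ^ s * b l ^ (1 - s) * w j l - s * ∑ j, ∑ l, a j * w j l -
        (1 - s) * ∑ j, ∑ l, b l * w j l := by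
    simp only [Finset.mul_sum, ← Finset.sum_sub_distrib]
    exact Finset.sum_congr rfl fun j _ => Finset.sum_congr rfl fun l _ => by ring
  simp only [sub_mul (‖_‖ ^ 2), Finset.sum_sub_distrib]
  rw [split, split, e1, e2, e3, e4, trace_conjDiag_mul, trace_conjDiag_mul]
  ring

lemma exists_abs_trace_sub_le (n p z : Type*) [Fintype n] [DecidableEq n] [Fintype p]
    [DecidableEq p] [Fintype z] [DecidableEq z] {ℓ : ℝ} (hℓ : 0 < ℓ) (η : ℝ) :
    ∃ C : ℝ, 0 ≤ C ∧ ∀ {lam : p → ℝ} {ε ε₁ ε₂ : ℝ} {N₁ N₂ : Matrix (p ⊕ z) (p ⊕ z) ℂ}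
      {O₁ O₂ : Matrix (p ⊕ z) n ℂ} {a b : n → ℝ} {F₁ F₂ : Matrix z z ℂ} {d e : z → ℝ},
      IsSpectralData lam ℓ η ε₁ N₁ O₁ a F₁ d → IsSpectralData lam ℓ η ε₂ N₂ O₂ b F₂ e →
      ε ≤ 1 → ε₁ ≤ ε → ε₂ ≤ ε → ∀ s : ℝ, 0 ≤ s → s ≤ 1 →
      |(conjDiag O₁ (fun j => a j ^ s) * conjDiag O₂ (fun j => b j ^ (1 - s))).trace.re - 1 -
      ((conjDiag O₁.toRows₂ (fun j => a j ^ s) *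
          conjDiag O₂.toRows₂ (fun j => b j ^ (1 - s))).trace.re -
        s * N₁.toBlocks₂₂.trace.re - (1 - s) * N₂.toBlocks₂₂.trace.re)| ≤ C * ε ^ 2 := by
  set B : ℝ := Fintype.card p * (1 + Fintype.card z) / ℓ ^ 2 +
        (((Fintype.card p + Fintype.card z) / ℓ) ^ 2 + (Fintype.card z / ℓ) ^ 2) +
        (4 / ℓ + (Fintype.card z / ℓ ^ 2) ^ 2) with hB
  refine ⟨Fintype.card n * (Fintype.card n * B), by positivity, ?_⟩
  intro lam ε ε₁ ε₂ N₁ N₂ O₁ O₂ a b F₁ F₂ d e h₁ h₂ hε hε₁ hε₂ s hs hs'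
  rw [← h₁.sum_overlap_sub_mul_gap h₂ s, mul_assoc, mul_assoc, ← nsmul_eq_mul, ← nsmul_eq_mul]
  refine (Finset.abs_sum_le_sum_abs _ _).trans (Finset.sum_le_card_nsmul _ _ _ fun j _ => ?_)
  refine (Finset.abs_sum_le_sum_abs _ _).trans (Finset.sum_le_card_nsmul _ _ _ fun l _ => ?_)
  exact h₁.abs_overlap_sub_mul_gap_le h₂ hε hε₁ hε₂ hs hs' j l

/-- Each factor has error `ε` relative to its size `ε ^ s` or `ε ^ (1 - s)`, and these sizes
multiply to `ε`. -/
lemma exists_abs_trace_block_sub_le (n p z : Type*) [Fintype n] [DecidableEq n] [Fintype p]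
    [DecidableEq p] [Fintype z] [DecidableEq z] {ℓ η : ℝ} (hℓ : 0 < ℓ) (hη : 0 < η) :
    ∃ C : ℝ, 0 ≤ C ∧ ∀ {lam : p → ℝ} {ε ε₁ ε₂ : ℝ} {N₁ N₂ : Matrix (p ⊕ z) (p ⊕ z) ℂ}
      {O₁ O₂ : Matrix (p ⊕ z) n ℂ} {a b : n → ℝ} {F₁ F₂ : Matrix z z ℂ} {d e : z → ℝ},
      IsSpectralData lam ℓ η ε₁ N₁ O₁ a F₁ d → IsSpectralData lam ℓ η ε₂ N₂ O₂ b F₂ e →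
      ε ≤ 1 → ε₁ ≤ ε → ε₂ ≤ ε → ∀ s : ℝ, 0 ≤ s → s ≤ 1 →
      |(conjDiag O₁.toRows₂ (fun j => a j ^ s) *
          conjDiag O₂.toRows₂ (fun j => b j ^ (1 - s))).trace.re -
        (conjDiag F₁ (fun k => d k ^ s) * conjDiag F₂ (fun k => e k ^ (1 - s))).trace.re| ≤
        C * ε ^ 2 := by
  set B : ℝ := Fintype.card z ^ 2 * (Fintype.card n * (Fintype.card p * Fintype.card z / (ℓ * η) +
        (Fintype.card z / ℓ) ^ 2)) with hB
  set Z : ℝ := (Fintype.card z : ℝ) with hZ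
  have hB0 : 0 ≤ B := by positivity
  have hZ0 : 0 ≤ Z := by positivity
  refine ⟨Z * (Z * (2 * B * Z + B ^ 2)), by positivity, ?_⟩
  intro lam ε ε₁ ε₂ N₁ N₂ O₁ O₂ a b F₁ F₂ d e h₁ h₂ hε hε₁ hε₂ s hs hs'
  have hε₁0 := h₁.ε_nonneg
  have hε₂0 := h₂.ε_nonneg
  have hε0 : 0 ≤ ε := hε₁0.trans hε₁
  have hs1 : 0 ≤ 1 - s := by linarith
  set D₁ := conjDiag F₁ (fun k => d k ^ s) with hD₁
  set D₂ := conjDiag F₂ (fun k => e k ^ (1 - s)) with hD₂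
  set G₁ := conjDiag O₁.toRows₂ (fun j => a j ^ s) with hG₁
  set G₂ := conjDiag O₂.toRows₂ (fun j => b j ^ (1 - s)) with hG₂
  have hεs : ε₁ ^ s ≤ ε ^ s := Real.rpow_le_rpow hε₁0 hε₁ hs
  have hεs' : ε₂ ^ (1 - s) ≤ ε ^ (1 - s) := Real.rpow_le_rpow hε₂0 hε₂ hs1
  have hp : 0 ≤ ε ^ s := by positivity
  have hp' : 0 ≤ ε ^ (1 - s) := by positivity
  have hmul : ε ^ s * ε ^ (1 - s) = ε := by
    rw [← Real.rpow_add_of_nonneg hε0 hs hs1]; simp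
  have bD₁ (i l : z) : ‖D₁ i l‖ ≤ Z * ε ^ s :=
    (h₁.norm_conjDiag_block_apply_le hs i l).trans (by gcongr)
  have bD₂ (i l : z) : ‖D₂ i l‖ ≤ Z * ε ^ (1 - s) :=
    (h₂.norm_conjDiag_block_apply_le hs1 i l).trans (by gcongr)
  have bE₁ (i l : z) : ‖(G₁ - D₁) i l‖ ≤ B * (ε * ε ^ s) :=
    (h₁.norm_conjDiag_sub_apply_le hs hs' i l).trans (by gcongr)
  have bE₂ (i l : z) : ‖(G₂ - D₂) i l‖ ≤ B * (ε * ε ^ (1 - s)) :=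
    (h₂.norm_conjDiag_sub_apply_le hs1 (by linarith) i l).trans (by gcongr)
  have key : (G₁ * G₂).trace.re - (D₁ * D₂).trace.re = ((G₁ - D₁) * D₂).trace.re +
      ((G₁ - D₁) * (G₂ - D₂)).trace.re + (D₁ * (G₂ - D₂)).trace.re := by
    simp only [Matrix.sub_mul, Matrix.mul_sub, Matrix.trace_sub, Complex.sub_re]
    ring
  have b1 := (Complex.abs_re_le_norm _).trans
    (norm_trace_mul_le (G₁ - D₁) D₂ (by positivity) bE₁ bD₂)
  have b2 := (Complex.abs_re_le_norm _).trans
    (norm_trace_mul_le (G₁ - D₁) (G₂ - D₂) (by positivity) bE₁ bE₂)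
  have b3 := (Complex.abs_re_le_norm _).trans
    (norm_trace_mul_le D₁ (G₂ - D₂) (by positivity) bD₁ bE₂)
  have c1 : Z * (Z * (B * (ε * ε ^ s) * (Z * ε ^ (1 - s)))) = Z * (Z * (B * Z)) * ε ^ 2 := by
    linear_combination Z * Z * B * Z * ε * hmul
  have c2 : Z * (Z * (B * (ε * ε ^ s) * (B * (ε * ε ^ (1 - s))))) ≤ Z * (Z * B ^ 2) * ε ^ 2 := by
    calc _ = Z * (Z * B ^ 2) * (ε ^ 2 * ε) := by
          linear_combination Z * Z * B ^ 2 * ε ^ 2 * hmul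
      _ ≤ Z * (Z * B ^ 2) * (ε ^ 2 * 1) := by gcongr
      _ = _ := by ring
  have c3 : Z * (Z * (Z * ε ^ s * (B * (ε * ε ^ (1 - s))))) = Z * (Z * (B * Z)) * ε ^ 2 := by
    linear_combination Z * Z * B * Z * ε * hmul
  rw [← hZ] at b1 b2 b3
  rw [c1] at b1
  rw [c3] at b3
  rw [key]
  refine (abs_add_three _ _ _).trans ?_
  linarith

lemma abs_trace_block_le (h₁ : IsSpectralData lam ℓ η ε₁ N₁ O₁ a F₁ d)
    (h₂ : IsSpectralData lam ℓ η ε₂ N₂ O₂ b F₂ e) (hε₁ : ε₁ ≤ ε) (hε₂ : ε₂ ≤ ε)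
    {s : ℝ} (hs : 0 ≤ s) (hs' : s ≤ 1) :
    |(conjDiag F₁ (fun k => d k ^ s) * conjDiag F₂ (fun k => e k ^ (1 - s))).trace.re| ≤
      (Fintype.card z : ℝ) ^ 4 * ε := by
  have hε₁0 := h₁.ε_nonneg
  have hε₂0 := h₂.ε_nonneg
  have hε0 : 0 ≤ ε := hε₁0.trans hε₁
  have hs1 : 0 ≤ 1 - s := by linarith
  have hmul : ε ^ s * ε ^ (1 - s) = ε := by
    rw [← Real.rpow_add_of_nonneg hε0 hs hs1]; simp
  refine (Complex.abs_re_le_norm _).trans ((norm_trace_mul_le _ _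
    (x := Fintype.card z * ε ^ s) (y := Fintype.card z * ε ^ (1 - s)) (by positivity)
    (fun i l => (h₁.norm_conjDiag_block_apply_le hs i l).trans ?_)
    (fun i l => (h₂.norm_conjDiag_block_apply_le hs1 i l).trans ?_)).trans (le_of_eq ?_))
  · gcongr
  · gcongr
  · linear_combination (Fintype.card z : ℝ) ^ 4 * hmul

lemma abs_trace_toBlocks₁₁_le (h : IsSpectralData lam ℓ η ε₁ N₁ O₁ a F₁ d) :
    |N₁.toBlocks₁₁.trace.re| ≤ Fintype.card p * ε₁ := by
  refine (Complex.abs_re_le_norm _).trans ((norm_sum_le _ _).trans ?_)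
  rw [← nsmul_eq_mul]
  exact Finset.sum_le_card_nsmul _ _ _ fun i _ =>
    (norm_entry_le_hsNorm N₁ (Sum.inl i) (Sum.inl i)).trans h.hsNorm_le

end IsSpectralData

end ChernoffPert

/-! ### Extrema, continuity, and spectral data from the hypotheses. -/

namespace ChernoffPert

open Matrix

/-- A pointwise bound passes to extrema: evaluate at the maximizer of `g` and at the minimizer of
`f`. -/
lemma exists_isGreatest_isLeast_abs_sub_le {f g : ℝ → ℝ} {κ : ℝ}
    (hf : ContinuousOn f (Set.Icc 0 1)) (hg : ContinuousOn g (Set.Icc 0 1))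
    (hfg : ∀ s ∈ Set.Icc (0 : ℝ) 1, |g s - -f s| ≤ κ) :
    ∃ ξ m : ℝ, IsGreatest (g '' Set.Icc 0 1) ξ ∧ IsLeast (f '' Set.Icc 0 1) m ∧ |ξ - -m| ≤ κ := by
  have hne : (Set.Icc (0 : ℝ) 1).Nonempty := ⟨0, by simp⟩
  obtain ⟨u, hu, hmax⟩ := isCompact_Icc.exists_isMaxOn hne hg
  obtain ⟨v, hv, hmin⟩ := isCompact_Icc.exists_isMinOn hne hf
  refine ⟨g u, f v, ⟨⟨u, hu, rfl⟩, ?_⟩, ⟨⟨v, hv, rfl⟩, ?_⟩, ?_⟩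
  · rintro _ ⟨s, hs, rfl⟩
    exact hmax hs
  · rintro _ ⟨s, hs, rfl⟩
    exact hmin hs
  · have h1 := abs_le.1 (hfg u hu)
    have h2 := abs_le.1 (hfg v hv)
    have h3 : g v ≤ g u := hmax hv
    have h4 : f v ≤ f u := hmin hu
    rw [abs_le]
    constructor <;> linarith

/-- Positivity matters at the endpoints: `0 ^ s` jumps at `s = 0`. -/
lemma continuous_trace_conjDiag_rpow_mul {m n k : Type*} [Fintype m] [Fintype n] [DecidableEq n]
    [Fintype k] [DecidableEq k] (X : Matrix m n ℂ) (Y : Matrix m k ℂ) {α : n → ℝ} {β : k → ℝ}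
    (hα : ∀ j, 0 < α j) (hβ : ∀ j, 0 < β j) :
    Continuous fun s : ℝ =>
      (conjDiag X (fun j => α j ^ s) * conjDiag Y (fun j => β j ^ (1 - s))).trace.re := by
  simp only [trace_conjDiag_mul]
  refine continuous_finsetSum _ fun j _ => continuous_finsetSum _ fun l _ => ?_
  have h1 : Continuous fun s : ℝ => α j ^ s := Real.continuous_const_rpow (hα j).ne'
  have h2 : Continuous fun s : ℝ => β l ^ (1 - s) :=
    (Real.continuous_const_rpow (hβ l).ne').comp (continuous_const.sub continuous_id)
  exact (h1.mul h2).mul continuous_const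

variable {n p z : Type*} [Fintype n] [DecidableEq n] [Fintype p] [DecidableEq p]
    [Fintype z] [DecidableEq z] {ρ₀ ν : Matrix n n ℂ} {U : Matrix n (p ⊕ z) ℂ} {lam : p → ℝ}
    {K c ℓ : ℝ}

lemma hsNorm_conj (hU : IsEigenbasis ρ₀ U lam) (ν : Matrix n n ℂ) :
    hsNorm (Uᴴ * ν * U) = hsNorm ν := by
  rw [hsNorm_mul_of_coisometry _ hU.mul_conjTranspose, hsNorm_mul_of_isometry]
  rw [Matrix.conjTranspose_conjTranspose, hU.mul_conjTranspose]

lemma conj_add (hU : IsEigenbasis ρ₀ U lam) (ν : Matrix n n ℂ) :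
    Uᴴ * (ρ₀ + ν) * U =
      Matrix.fromBlocks (Matrix.diagonal fun k => (lam k : ℂ)) 0 0 0 + Uᴴ * ν * U := by
  rw [Matrix.mul_add, Matrix.add_mul, hU.eq_blocks]

lemma trace_blockB_add_trace_blockD (hU : IsEigenbasis ρ₀ U lam) (ν : Matrix n n ℂ) :
    (blockB U ν).trace + (blockD U ν).trace = ν.trace := by
  have h : (Uᴴ * ν * U).trace = ν.trace := by
    rw [Matrix.trace_mul_comm, ← Matrix.mul_assoc, hU.mul_conjTranspose, Matrix.one_mul]
  rw [← h]
  simp [Matrix.trace, blockB, blockD, Matrix.toBlocks₁₁, Matrix.toBlocks₂₂]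

lemma posSemidef_blockD (hU : IsEigenbasis ρ₀ U lam) (h : IsStatePerturbation ρ₀ ν) :
    (blockD U ν).PosSemidef := by
  have h1 := (h.posSemidef.conjTranspose_mul_mul_same U).submatrix (Sum.inr : z → p ⊕ z)
  rw [conj_add hU] at h1
  convert h1 using 1
  ext i j
  simp [blockD, Matrix.toBlocks₂₂]

/-- A support-extending perturbation does not vanish on the kernel of the unperturbed state. -/
lemma hsNorm_blockD_pos (hU : IsEigenbasis ρ₀ U lam) (h : IsSupportExtending K c ρ₀ U ν) (k : z) :
    0 < hsNorm (blockD U ν) := by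
  -- The ratio hypothesis alone need not exclude a zero block, as its quotient is then `0`. Instead,
  -- a kernel basis vector `v` with zero diagonal entry is annihilated by the positive matrix `ρ₀ +
  -- ν`, hence by `ν`, yet it lies in `supp ν`.
  refine (hsNorm_nonneg _).lt_of_ne' fun h0 => ?_
  set v : n → ℂ := fun i => U i (Sum.inr k) with hv
  have hUk : U *ᵥ Pi.single (Sum.inr k) 1 = v := by
    ext i; simp [hv]
  have hentry : (Uᴴ * ν * U) (Sum.inr k) (Sum.inr k) = 0 := by
    have := norm_entry_le_hsNorm (blockD U ν) k k
    rw [h0] at this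
    exact norm_le_zero_iff.1 this
  have hρ₀v : ρ₀ *ᵥ v = 0 := by
    have e : ρ₀ * U = U * (Matrix.fromBlocks (Matrix.diagonal fun k => (lam k : ℂ)) 0 0 0 :
        Matrix (p ⊕ z) (p ⊕ z) ℂ) := by
      rw [← hU.eq_blocks, Matrix.mul_assoc, ← Matrix.mul_assoc U, hU.mul_conjTranspose,
        Matrix.one_mul]
    rw [← hUk, Matrix.mulVec_mulVec, e, ← Matrix.mulVec_mulVec]
    have e' : (Matrix.fromBlocks (Matrix.diagonal fun k => (lam k : ℂ)) 0 0 0 :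
        Matrix (p ⊕ z) (p ⊕ z) ℂ) *ᵥ Pi.single (Sum.inr k) 1 = 0 := by
      rw [Matrix.mulVec_single_one]
      funext i
      rcases i with i | i <;> simp
    rw [e', Matrix.mulVec_zero]
  have hρv : (ρ₀ + ν) *ᵥ v = 0 := by
    rw [← h.posSemidef.dotProduct_mulVec_zero_iff]
    have e : (Uᴴ * (ρ₀ + ν) * U) (Sum.inr k) (Sum.inr k) = 0 := by
      rw [conj_add hU, Matrix.add_apply, hentry]; simp
    rw [← e, Matrix.mul_assoc, Matrix.mul_apply]
    simp [dotProduct, Matrix.mulVec, Matrix.mul_apply, hv]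
  have hνv : ν *ᵥ v = 0 := by
    rwa [Matrix.add_mulVec, hρ₀v, zero_add] at hρv
  set w : EuclideanSpace ℂ n := WithLp.toLp 2 v with hw
  have hw1 : w ∈ LinearMap.ker (Matrix.toEuclideanLin ρ₀) := by
    rw [LinearMap.mem_ker, hw, Matrix.toLpLin_toLp]
    simp [hρ₀v]
  have hw2 : w ∈ LinearMap.ker (Matrix.toEuclideanLin ν) := by
    rw [LinearMap.mem_ker, hw, Matrix.toLpLin_toLp]
    simp [hνv]
  have hw3 := Submodule.inner_right_of_mem_orthogonal hw2 (h.ker_le_supp hw1)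
  rw [inner_self_eq_zero] at hw3
  have hv0 : v = 0 := by
    have := congrArg WithLp.ofLp hw3
    simpa [hw] using this
  have h1 := congrFun (congrFun hU.conjTranspose_mul (Sum.inr k)) (Sum.inr k)
  rw [Matrix.mul_apply, Matrix.one_apply_eq] at h1
  have h2 (i : n) : U i (Sum.inr k) = 0 := congrFun hv0 i
  simp [h2] at h1

/-- The index `k` records that the kernel is nonzero; `max K 1` keeps the constant positive for
later division. -/
lemma hsNorm_le_mul_hsNorm_blockD (hU : IsEigenbasis ρ₀ U lam)
    (h : IsSupportExtending K c ρ₀ U ν) (k : z) :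
    hsNorm ν ≤ max K 1 * hsNorm (blockD U ν) := by
  have hD := hsNorm_blockD_pos hU h k
  have hle : hsNorm (blockD U ν) ≤ hsNorm ν :=
    (hsNorm_toBlocks₂₂_le (Uᴴ * ν * U)).trans (hsNorm_conj hU ν).le
  have hν : 0 < hsNorm ν := hD.trans_le hle
  have h1 := h.ratio_le
  rw [div_le_iff₀ hD, sq, mul_assoc, mul_comm (hsNorm ν) (hsNorm (blockD U ν)), ← mul_assoc] at h1
  exact (le_of_mul_le_mul_right h1 hν).trans (by gcongr; exact le_max_left _ _)

/-- The value `η = c / max K 1` comes from `d k ≥ c ‖ν_D‖ ≥ (c / max K 1) ‖ν‖`. -/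
lemma exists_isSpectralData (hρ₀ : IsState ρ₀) (hU : IsEigenbasis ρ₀ U lam) (hc : 0 < c)
    (hℓ : 0 < ℓ) (hlam : ∀ k, 2 * ℓ ≤ lam k) (h : IsSupportExtending K c ρ₀ U ν)
    (hν : hsNorm ν ≤ 1) :
    ∃ (W : Matrix n n ℂ) (a : n → ℝ) (F : Matrix z z ℂ) (d : z → ℝ),
      (∀ s, mpow (ρ₀ + ν) s = conjDiag W (fun j => a j ^ s)) ∧
      (∀ s, mpow (blockD U ν) s = conjDiag F (fun j => d j ^ s)) ∧
      IsSpectralData lam ℓ (c / max K 1) (hsNorm ν) (Uᴴ * ν * U) (Uᴴ * W) a F d := by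
  obtain ⟨W, a, hW, hW', hWa, ha, hpow⟩ := exists_unitary_conjDiag h.posSemidef
  obtain ⟨F, d, hF, hF', hFd, hd, hpowD⟩ := exists_unitary_conjDiag (posSemidef_blockD hU h.1)
  have hK : 0 < max K 1 := lt_max_of_lt_right one_pos
  have hFdF : Fᴴ * blockD U ν * F = Matrix.diagonal (fun k => (d k : ℂ)) := by
    rw [hFd, conjTranspose_mul_conjDiag_mul_self hF]
  have hdlow (k : z) : c * hsNorm (blockD U ν) ≤ d k := by
    have h1 := h.full_rank.conjTranspose_mul_mul_same F
    rw [Matrix.mul_sub, Matrix.sub_mul, hFdF, Matrix.mul_smul, Matrix.smul_mul, Matrix.mul_one,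
      hF] at h1
    have h2 := (Complex.le_def.1 (h1.diag_nonneg (i := k))).1
    simp only [Matrix.sub_apply, Matrix.smul_apply, Matrix.diagonal_apply_eq,
      Matrix.one_apply_eq, smul_eq_mul, mul_one, Complex.sub_re, Complex.ofReal_re,
      Complex.zero_re] at h2
    linarith
  refine ⟨W, a, F, d, hpow, hpowD, ?_⟩
  have hUU := hU.mul_conjTranspose
  refine
    { gap_pos := hℓ
      two_mul_gap_le := hlam
      η_pos := by positivity
      ε_nonneg := hsNorm_nonneg _
      ε_le_one := hν
      hsNorm_le := (hsNorm_conj hU ν).le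
      isometry := ?_
      coisometry := ?_
      conjDiag_eq := ?_
      nonneg := ha
      sum_eq_one := ?_
      block_isometry := hF
      block_coisometry := hF'
      block_eq := hFd
      block_pos := fun k => (mul_pos hc (hsNorm_blockD_pos hU h k)).trans_le (hdlow k)
      le_block := fun k => ?_
      block_le := fun k => ?_ }
  · rw [Matrix.conjTranspose_mul, Matrix.conjTranspose_conjTranspose, Matrix.mul_assoc,
      ← Matrix.mul_assoc U, hUU, Matrix.one_mul, hW]
  · rw [Matrix.conjTranspose_mul, Matrix.conjTranspose_conjTranspose, Matrix.mul_assoc,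
      ← Matrix.mul_assoc W, hW', Matrix.one_mul, hU.conjTranspose_mul]
  · rw [conjDiag_mul_left, Matrix.conjTranspose_conjTranspose, ← hWa, conj_add hU]
  · have h1 : (ρ₀ + ν).trace = 1 := by
      rw [Matrix.trace_add, hρ₀.2, h.trace_eq_zero, add_zero]
    rw [hWa, conjDiag, Matrix.trace_mul_comm, ← Matrix.mul_assoc, hW, Matrix.one_mul,
      Matrix.trace_diagonal, ← Complex.ofReal_sum] at h1
    exact_mod_cast h1
  · refine le_trans ?_ (hdlow k)
    rw [div_mul_eq_mul_div, div_le_iff₀ hK, mul_assoc]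
    gcongr
    rw [mul_comm]
    exact hsNorm_le_mul_hsNorm_blockD hU h k
  · have h1 : d k = ‖(Fᴴ * blockD U ν * F) k k‖ := by
      rw [hFdF, Matrix.diagonal_apply_eq, Complex.norm_real, Real.norm_of_nonneg (hd k)]
    rw [h1]
    refine (norm_entry_le_hsNorm _ _ _).trans ?_
    rw [hsNorm_mul_of_coisometry _ hF', hsNorm_mul_of_isometry _
      (by rw [Matrix.conjTranspose_conjTranspose, hF'])]
    exact (hsNorm_toBlocks₂₂_le (Uᴴ * ν * U)).trans (hsNorm_conj hU ν).le

lemma exists_gap (hU : IsEigenbasis ρ₀ U lam) : ∃ ℓ > (0 : ℝ), ∀ k, 2 * ℓ ≤ lam k := by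
  cases isEmpty_or_nonempty p with
  | inl _ => exact ⟨1, one_pos, fun k => isEmptyElim k⟩
  | inr _ =>
    obtain ⟨k₀, hk₀⟩ := Finite.exists_min lam
    exact ⟨lam k₀ / 2, half_pos (hU.pos k₀), fun k => by linarith [hk₀ k]⟩

end ChernoffPert

/-! ### Assembly of the main theorem. -/

open ChernoffPert

theorem theorem10 {n p z : Type*} [Fintype n] [DecidableEq n] [Fintype p] [DecidableEq p]
    [Fintype z] [DecidableEq z]
    (ρ₀ : Matrix n n ℂ) (hρ₀ : ChernoffPert.IsState ρ₀)
    (U : Matrix n (p ⊕ z) ℂ) (lam : p → ℝ) (hU : ChernoffPert.IsEigenbasis ρ₀ U lam)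
    (K c : ℝ) (hc : 0 < c) :
    ∃ C > (0 : ℝ), ∃ δ > (0 : ℝ), ∀ ν₁ ν₂ : Matrix n n ℂ,
      ChernoffPert.IsSupportExtending K c ρ₀ U ν₁ →
      ChernoffPert.IsSupportExtending K c ρ₀ U ν₂ →
      ChernoffPert.hsNorm ν₁ ≤ δ → ChernoffPert.hsNorm ν₂ ≤ δ →
      ∃ ξ m : ℝ, ChernoffPert.IsChernoffBound (ρ₀ + ν₁) (ρ₀ + ν₂) ξ ∧
        IsLeast (ChernoffPert.firstOrder U ν₁ ν₂ '' Set.Icc 0 1) m ∧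
        |ξ - (-m)| ≤ C * max (ChernoffPert.hsNorm ν₁) (ChernoffPert.hsNorm ν₂) ^ 2 := by
  obtain ⟨ℓ, hℓ, hlam⟩ := exists_gap hU
  set η : ℝ := c / max K 1 with hη
  have hη0 : 0 < η := div_pos hc (lt_max_of_lt_right one_pos)
  obtain ⟨B₁, hB₁, hcomp⟩ := IsSpectralData.exists_abs_trace_sub_le n p z hℓ η
  obtain ⟨B₂, hB₂, hblock⟩ := IsSpectralData.exists_abs_trace_block_sub_le n p z hℓ hη0
  set P : ℝ := (Fintype.card p : ℝ) with hP
  set Z : ℝ := (Fintype.card z : ℝ) with hZ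
  have hP0 : 0 ≤ P := by positivity
  have hZ0 : 0 ≤ Z := by positivity
  set A : ℝ := P + Z ^ 4 + B₁ + B₂ with hA
  have hA0 : 0 ≤ A := by positivity
  set M : ℝ := (P + Z) * (1 / ℓ + Z * (P * Z / (ℓ * η))) ^ 2 with hM
  have hM0 : 0 ≤ M := by positivity
  -- `2 * A ^ 2` is the logarithm's quadratic remainder, `B₁ + B₂` the trace error, and `1` makes
  -- the constant positive. The radius ensures `ε ≤ 1`, `A * ε ≤ 1 / 2` for the logarithm and `M * ε
  -- < 1` for positive eigenvalues.
  refine ⟨2 * A ^ 2 + B₁ + B₂ + 1, by positivity, 1 / (2 * (A + M + 1)), by positivity, ?_⟩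
  intro ν₁ ν₂ h₁ h₂ hδ₁ hδ₂
  set ε := max (hsNorm ν₁) (hsNorm ν₂) with hεdef
  have hε₁ : hsNorm ν₁ ≤ ε := le_max_left _ _
  have hε₂ : hsNorm ν₂ ≤ ε := le_max_right _ _
  have hε0 : 0 ≤ ε := (hsNorm_nonneg ν₁).trans hε₁
  have hεδ : ε * (2 * (A + M + 1)) ≤ 1 := by
    rw [← le_div_iff₀ (by positivity)]
    exact max_le hδ₁ hδ₂
  have hAε : 0 ≤ A * ε := by positivity
  have hMε : 0 ≤ M * ε := by positivity
  have hε1 : ε ≤ 1 := by nlinarith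
  have hAε' : A * ε ≤ 1 / 2 := by nlinarith
  have hMε' : M * ε < 1 := by nlinarith
  obtain ⟨W₁, a, F₁, d, hp₁, hq₁, H₁⟩ :=
    exists_isSpectralData hρ₀ hU hc hℓ hlam h₁ (hε₁.trans hε1)
  obtain ⟨W₂, b, F₂, e, hp₂, hq₂, H₂⟩ :=
    exists_isSpectralData hρ₀ hU hc hℓ hlam h₂ (hε₂.trans hε1)
  have ha : ∀ j, 0 < a j := H₁.pos ((mul_le_mul_of_nonneg_left hε₁ hM0).trans_lt hMε')
  have hb : ∀ j, 0 < b j := H₂.pos ((mul_le_mul_of_nonneg_left hε₂ hM0).trans_lt hMε')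
  have hT (s : ℝ) : (mpow (ρ₀ + ν₁) s * mpow (ρ₀ + ν₂) (1 - s)).trace.re =
      (conjDiag (Uᴴ * W₁) (fun j => a j ^ s) *
        conjDiag (Uᴴ * W₂) (fun j => b j ^ (1 - s))).trace.re := by
    rw [hp₁, hp₂, trace_conjDiag_mul, trace_conjDiag_mul, Matrix.conjTranspose_mul,
      Matrix.conjTranspose_conjTranspose, Matrix.mul_assoc, ← Matrix.mul_assoc U,
      hU.mul_conjTranspose, Matrix.one_mul]
  -- Tracelessness turns the kernel traces into the `ν_B` terms of the first-order expression.
  have htr {ν : Matrix n n ℂ} (h : IsSupportExtending K c ρ₀ U ν) :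
      ((Uᴴ * ν * U).toBlocks₂₂).trace.re = -(blockB U ν).trace.re := by
    have := congrArg Complex.re (trace_blockB_add_trace_blockD hU ν)
    rw [h.trace_eq_zero, Complex.add_re, Complex.zero_re] at this
    exact eq_neg_of_add_eq_zero_right this
  have hr (s : ℝ) (hs : s ∈ Set.Icc (0 : ℝ) 1) :
      |(mpow (ρ₀ + ν₁) s * mpow (ρ₀ + ν₂) (1 - s)).trace.re - 1 - firstOrder U ν₁ ν₂ s| ≤
        (B₁ + B₂) * ε ^ 2 := by
    have e1 := abs_le.1 (hcomp H₁ H₂ hε1 hε₁ hε₂ s hs.1 hs.2)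
    have e2 := abs_le.1 (hblock H₁ H₂ hε1 hε₁ hε₂ s hs.1 hs.2)
    rw [htr h₁, htr h₂] at e1
    rw [hT, firstOrder, hq₁, hq₂, abs_le]
    constructor <;> linarith
  have hf (s : ℝ) (hs : s ∈ Set.Icc (0 : ℝ) 1) : |firstOrder U ν₁ ν₂ s| ≤ (P + Z ^ 4) * ε := by
    have e1 := H₁.abs_trace_block_le H₂ hε₁ hε₂ hs.1 hs.2
    have e2 : |(blockB U ν₁).trace.re| ≤ P * ε :=
      H₁.abs_trace_toBlocks₁₁_le.trans (mul_le_mul_of_nonneg_left hε₁ hP0)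
    have e3 : |(blockB U ν₂).trace.re| ≤ P * ε :=
      H₂.abs_trace_toBlocks₁₁_le.trans (mul_le_mul_of_nonneg_left hε₂ hP0)
    rw [firstOrder, hq₁, hq₂]
    refine (abs_add_three _ _ _).trans ?_
    rw [abs_mul, abs_mul, abs_of_nonneg hs.1, abs_of_nonneg (sub_nonneg.2 hs.2)]
    have e4 := mul_le_mul_of_nonneg_left e2 hs.1
    have e5 := mul_le_mul_of_nonneg_left e3 (sub_nonneg.2 hs.2)
    linarith
  have hx (s : ℝ) (hs : s ∈ Set.Icc (0 : ℝ) 1) :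
      |(mpow (ρ₀ + ν₁) s * mpow (ρ₀ + ν₂) (1 - s)).trace.re - 1| ≤ A * ε := by
    have e1 := abs_le.1 (hr s hs)
    have e2 := abs_le.1 (hf s hs)
    have e3 : (B₁ + B₂) * ε ^ 2 ≤ (B₁ + B₂) * ε := by
      gcongr
      nlinarith
    rw [abs_le]
    constructor <;> linarith
  refine exists_isGreatest_isLeast_abs_sub_le (f := firstOrder U ν₁ ν₂)
    (g := chernoff (ρ₀ + ν₁) (ρ₀ + ν₂)) ?_ ?_ fun s hs => ?_
  · have := continuous_trace_conjDiag_rpow_mul F₁ F₂ H₁.block_pos H₂.block_pos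
    simp only [← hq₁, ← hq₂] at this
    refine Continuous.continuousOn ?_
    exact ((continuous_id.mul continuous_const).add
      ((continuous_const.sub continuous_id).mul continuous_const)).add this
  · have := continuous_trace_conjDiag_rpow_mul (Uᴴ * W₁) (Uᴴ * W₂) ha hb
    simp only [← hT] at this
    refine (ContinuousOn.log this.continuousOn fun s hs => ?_).neg
    have := abs_le.1 (hx s hs)
    linarith
  · have e1 := hx s hs
    have e2 := abs_log_one_add_sub_le (e1.trans hAε')
    rw [add_sub_cancel] at e2
    have e3 : ((mpow (ρ₀ + ν₁) s * mpow (ρ₀ + ν₂) (1 - s)).trace.re - 1) ^ 2 ≤ A ^ 2 * ε ^ 2 := by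
      rw [← mul_pow, ← sq_abs]
      gcongr
    have e4 := abs_le.1 e2
    have e5 := abs_le.1 (hr s hs)
    rw [chernoff, abs_le]
    constructor <;> linarith [sq_nonneg ε]
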